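/- Let $p>3$ be a prime and let $\varepsilon\in\mathbb{Z}/p\mathbb{Z}$ be a nonsquare. Let $\varphi:\mathrm{GL}_2(\mathbb{Z}/p^2\mathbb{Z})\to\mathrm{GL}_2(\mathbb{Z}/p\mathbb{Z})$ be reduction modulo $p$. Subgroups $H_1,H_2$ of a group $G$ are called locally conjugate in $G$ if there is a bijection $f:H_1\to H_2$ such that $h$ and $f(h)$ are conjugate in $G$ for every $h\in H_1$; they are nontrivially locally conjugate if in addition they are not conjugate in $G$. Two subgroups $D,D'$ of the group $C_s(p^2)$ of diagonal matrices in $\mathrm{GL}_2(\mathbb{Z}/p^2\mathbb{Z})$ are diagonal swaps if $\begin{pmatrix} w&0\\0&z\end{pmatrix}\in D$ exactly when $\begin{pmatrix} z&0\\0&w\end{pmatrix}\in D'$. For a matrix $A$ over $\mathbb{Z}/p\mathbb{Z}$, $Ap$ denotes the matrix over $\mathbb{Z}/p^2\mathbb{Z}$ obtained by lifting the entries of $A$ and multiplying by $p$. Let $H_1,H_2\le \mathrm{GL}_2(\mathbb{Z}/p^2\mathbb{Z})$ be nontrivially locally conjugate in $\mathrm{GL}_2(\mathbb{Z}/p^2\mathbb{Z})$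 with $\begin{pmatrix}1&1\\0&1\end{pmatrix}\in\varphi(H_1)$ and $\begin{pmatrix}1&1\\0&1\end{pmatrix}\in\varphi(H_2)$. Then $H_1$ and $H_2$ are, in some order, conjugate in $\mathrm{GL}_2(\mathbb{Z}/p^2\mathbb{Z})$ to $$\langle \tau,k,D\rangle \quad\text{and}\quad \langle \tau,k,D'\rangle ,$$ where $\tau$ is one of 1. $\begin{pmatrix}1&1\\0&1\end{pmatrix}$, 2. $\begin{pmatrix}1&1\\0&1\end{pmatrix}+\begin{pmatrix}1&0\\0&1\end{pmatrix}p$, 3. $\begin{pmatrix}1&1\\0&1\end{pmatrix}+\begin{pmatrix}a&0\\1&a\end{pmatrix}p$ for some $a\in\mathbb{Z}/p\mathbb{Z}$, 4. $\begin{pmatrix}1&1\\0&1\end{pmatrix}+\begin{pmatrix}a&0\\\varepsilon&a\end{pmatrix}p$ for some $a\in\mathbb{Z}/p\mathbb{Z}$, $k$ is one of $I$ and $I+\begin{pmatrix}0&0\\1&0\end{pmatrix}p$, and $D$, $D'$ are subgroups of $C_s(p^2)$ that are diagonal swaps with $D\ne D'$. -/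

import Mathlib

open scoped MatrixGroups

namespace LocConj

section Group

variable {G : Type*} [Group G]

/-- Two subgroups are locally conjugate in `G` if some bijection between them sends every
element to an element that is conjugate to it in `G`. -/
def LocallyConjugate (H₁ H₂ : Subgroup G) : Prop :=
  ∃ f : H₁ ≃ H₂, ∀ h : H₁, IsConj (h : G) (f h : G)

/-- `g H₁ g⁻¹ = H₂` for some `g` in `G`. -/
def ConjugateSubgroups (H₁ H₂ : Subgroup G) : Prop :=
  ∃ g : G, H₁.map (MulAut.conj g).toMonoidHom = H₂

/-- Locally conjugate in `G`, but not conjugate in `G`. -/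
def NontriviallyLocallyConjugate (H₁ H₂ : Subgroup G) : Prop :=
  LocallyConjugate H₁ H₂ ∧ ¬ ConjugateSubgroups H₁ H₂

end Group

section Ring

variable {R : Type*} [CommRing R]

/-- The invertible diagonal matrix with diagonal entries `w`, `z`. -/
def diagGL (w z : Rˣ) : GL (Fin 2) R where
  val := !![(w : R), 0; 0, (z : R)]
  inv := !![((w⁻¹ : Rˣ) : R), 0; 0, ((z⁻¹ : Rˣ) : R)]
  val_inv := by simp [Matrix.one_fin_two]
  inv_val := by simp [Matrix.one_fin_two]

variable (R) in
/-- The split Cartan subgroup: all diagonal matrices in `GL₂(R)`. -/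
def splitCartan : Subgroup (GL (Fin 2) R) where
  carrier := {g | ∃ w z : Rˣ, g = diagGL w z}
  one_mem' := ⟨1, 1, by ext i j; fin_cases i <;> fin_cases j <;> simp [diagGL]⟩
  mul_mem' := by
    rintro _ _ ⟨w, z, rfl⟩ ⟨w', z', rfl⟩
    exact ⟨w * w', z * z', by
      ext i j; fin_cases i <;> fin_cases j <;> simp [diagGL, Matrix.mul_apply]⟩
  inv_mem' := by
    rintro _ ⟨w, z, rfl⟩
    exact ⟨w⁻¹, z⁻¹, Units.ext rfl⟩

/-- For two subgroups of the split Cartan subgroup: `diag(w, z)` lies in the first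
exactly when `diag(z, w)` lies in the second. -/
def DiagonalSwaps (D₁ D₂ : Subgroup (GL (Fin 2) R)) : Prop :=
  D₁ ≤ splitCartan R ∧ D₂ ≤ splitCartan R ∧
    ∀ w z : Rˣ, diagGL w z ∈ D₁ ↔ diagGL z w ∈ D₂

variable (R) in
/-- The unipotent matrix with rows `(1, 1)` and `(0, 1)`. -/
def unipotent : GL (Fin 2) R where
  val := !![1, 1; 0, 1]
  inv := !![1, -1; 0, 1]
  val_inv := by simp [Matrix.one_fin_two]
  inv_val := by simp [Matrix.one_fin_two]

end Ring

/-- The natural homomorphism `GL₂(ℤ/p²ℤ) → GL₂(ℤ/pℤ)`, reduction of the entries modulo `p`. -/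
def reduction (p : ℕ) : GL (Fin 2) (ZMod (p ^ 2)) →* GL (Fin 2) (ZMod p) :=
  Matrix.GeneralLinearGroup.map (ZMod.castHom (dvd_pow_self p two_ne_zero) (ZMod p))

/-- For a matrix `A` over `ℤ/pℤ`, the matrix `A p` over `ℤ/p²ℤ`: lift the entries of `A` to
`ℤ/p²ℤ` and multiply by `p` (the product does not depend on the lifts). -/
def timesP {p : ℕ} (A : Matrix (Fin 2) (Fin 2) (ZMod p)) :
    Matrix (Fin 2) (Fin 2) (ZMod (p ^ 2)) :=
  (p : ZMod (p ^ 2)) • A.map (ZMod.cast : ZMod p → ZMod (p ^ 2))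

/-- The four kinds of lifts `τ` of the unipotent matrix; `ε` is a nonsquare modulo `p`. -/
def IsListedLift {p : ℕ} (ε : ZMod p) (τ : GL (Fin 2) (ZMod (p ^ 2))) : Prop :=
  (τ : Matrix (Fin 2) (Fin 2) (ZMod (p ^ 2))) = !![1, 1; 0, 1] ∨
  (τ : Matrix (Fin 2) (Fin 2) (ZMod (p ^ 2))) = !![1, 1; 0, 1] + timesP !![1, 0; 0, 1] ∨
  (∃ a : ZMod p, (τ : Matrix (Fin 2) (Fin 2) (ZMod (p ^ 2))) =
    !![1, 1; 0, 1] + timesP !![a, 0; 1, a]) ∨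
  (∃ a : ZMod p, (τ : Matrix (Fin 2) (Fin 2) (ZMod (p ^ 2))) =
    !![1, 1; 0, 1] + timesP !![a, 0; ε, a])

/-- `k` is `I` or `I + E₂₁ p`. -/
def IsListedKernelElement {p : ℕ} (k : GL (Fin 2) (ZMod (p ^ 2))) : Prop :=
  (k : Matrix (Fin 2) (Fin 2) (ZMod (p ^ 2))) = 1 ∨
  (k : Matrix (Fin 2) (Fin 2) (ZMod (p ^ 2))) = 1 + timesP !![0, 0; 1, 0]

/-- The subgroup `⟨τ, k, D⟩`. -/
def generated {p : ℕ} (τ k : GL (Fin 2) (ZMod (p ^ 2)))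
    (D : Subgroup (GL (Fin 2) (ZMod (p ^ 2)))) : Subgroup (GL (Fin 2) (ZMod (p ^ 2))) :=
  Subgroup.closure ({τ, k} ∪ (D : Set (GL (Fin 2) (ZMod (p ^ 2)))))

end LocConj

/-!
The congruence kernel `{1 + A p}` of `GL₂(ℤ/p²ℤ) → GL₂(ℤ/pℤ)` is `M₂(ℤ/pℤ)`, on which `GL₂(ℤ/p²ℤ)`
acts through conjugation by reductions. A subgroup `H` thus gives a subspace `kerModule H` of
`M₂(ℤ/pℤ)` that is stable under conjugation by the reduction of `H`. Write `u` for the unipotent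
matrix and let it be in the reduction of `H`. The `p`-th power of any lift of `u` is `1 + E₁₂ p`,
as `p > 3`, so `E₁₂` is in `kerModule H` (`e_mem_kerModule`), and as soon as `kerModule H`
contains a matrix that is not upper triangular, it contains `diag(1, -1)` (`h_mem_kerModule`). Of
local conjugacy only the following is used: each element of either subgroup is conjugate to an
element of the other one (`SameClasses`). This relation is stable under conjugating the two
subgroups separately, which allows normal forms.

If the reduction of `H₁` is not upper triangular, then `H₁` contains `SL₂(ℤ/p²ℤ)`
(`mem_of_not_upper`); so does `H₂`, because it contains elements without eigenvalues modulo `p`,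
and then the two subgroups have the same determinants and are equal (`eq_of_not_upper`).

Otherwise, both reductions are upper triangular. Call `H` graded if, in addition, diagonal
matrices in its reduction lift to diagonal matrices in `H`, and `kerModule H` contains `E₂₁` once
it has an element that is not upper triangular. A graded `H` is `⟨τ, k, D⟩` for any lift `τ ∈ H`
of `u`, with `D` the group of diagonal matrices in `H` (`Graded.eq_generated`). A diagonal matrix
conjugate to an element of a graded `H` is in `H` up to a swap of its entries
(`Graded.diagGL_mem_or`). As a group is not the union of two proper subgroups, two graded
subgroups with a common `τ` that meet the same classes have diagonal parts that are equal or
swapped (`Graded.listedPair`).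

It remains to make both subgroups graded and to give them a common listed `τ`.

* If some `h ∈ H` has distinct eigenvalues modulo `p`, it can be made diagonal by conjugation. The
  weights of `h` give the grading, and comparing `h τ h⁻¹` with a power of `τ` produces a lift of
  `u` in `H` that is determined by its lower left entry `c p`, where `c` is `0`, `1` or `ε` after
  a further diagonal conjugation (`exists_conj_graded`). The class of `c` modulo squares is an
  invariant, read off from the discriminant of the characteristic polynomial
  (`lower_entry_of_isConj`).
* If all elements have equal eigenvalues modulo `p`, a power of a lift of `u` in `H₁` is conjugate
  to a listed lift, and `H₂` contains a conjugate of it; so a common `τ` is available at once.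
  Scalars modulo `p` are lifted to scalars by taking `p`-th powers. The only obstruction to being
  graded is that `kerModule H` contains `E₂₁ + α` with `α ≠ 0` but not `E₂₁`. Such subgroups have
  a normal form with one parameter `b` (`NongradedForm`), and the characteristic polynomials of
  the elements determine for which `w` the number `1 - b w` is a square, hence `b`
  (`eq_of_isSquare_one_sub_iff`). So in this case the two subgroups are conjugate.
-/

namespace LocConj

/-! ### Multiplication by `p` as a map from `ℤ/pℤ` to `ℤ/p²ℤ` -/

lemma natCast_p_mul_self {p : ℕ} : (p : ZMod (p ^ 2)) * p = 0 := by
  have : ((p ^ 2 : ℕ) : ZMod (p ^ 2)) = 0 := ZMod.natCast_self _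
  rw [← this]; push_cast; ring

variable {p : ℕ} [Fact p.Prime]

variable (p) in
/-- The reduction map `ℤ/p²ℤ → ℤ/pℤ`. -/
def red : ZMod (p ^ 2) →+* ZMod p :=
  ZMod.castHom (dvd_pow_self p two_ne_zero) (ZMod p)

lemma red_cast (a : ZMod p) : red p (ZMod.cast a : ZMod (p ^ 2)) = a := by
  have : (ZMod.cast a : ZMod (p ^ 2)) = (a.val : ZMod (p ^ 2)) := by
    rw [ZMod.natCast_val]
  rw [this, map_natCast, ZMod.natCast_zmod_val]

lemma red_surjective : Function.Surjective (red p) := fun a => ⟨_, red_cast a⟩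

lemma red_eq_zero_iff_dvd (x : ZMod (p ^ 2)) : red p x = 0 ↔ ∃ y, x = (p : ZMod (p ^ 2)) * y := by
  constructor
  · intro h
    have hx : ((x.val : ℕ) : ZMod (p ^ 2)) = x := ZMod.natCast_zmod_val x
    rw [← hx, map_natCast, ZMod.natCast_eq_zero_iff] at h
    obtain ⟨k, hk⟩ := h
    exact ⟨k, by rw [← hx, hk]; push_cast; ring⟩
  · rintro ⟨y, rfl⟩
    simp

lemma natCast_p_mul_eq_zero_iff (x : ZMod (p ^ 2)) : (p : ZMod (p ^ 2)) * x = 0 ↔ red p x = 0 := by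
  constructor
  · intro h
    have hx : ((x.val : ℕ) : ZMod (p ^ 2)) = x := ZMod.natCast_zmod_val x
    rw [← hx, ← Nat.cast_mul, ZMod.natCast_eq_zero_iff] at h
    have h : p * p ∣ p * x.val := (dvd_of_eq (pow_two p).symm).trans h
    have := Nat.dvd_of_mul_dvd_mul_left (Fact.out : p.Prime).pos h
    rw [← hx, map_natCast, ZMod.natCast_eq_zero_iff]
    exact this
  · intro h
    obtain ⟨y, rfl⟩ := (red_eq_zero_iff_dvd x).1 h
    rw [← mul_assoc, natCast_p_mul_self, zero_mul]

lemma natCast_p_mul_congr {x y : ZMod (p ^ 2)} (h : red p x = red p y) :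
    (p : ZMod (p ^ 2)) * x = p * y := by
  rw [← sub_eq_zero, ← mul_sub, natCast_p_mul_eq_zero_iff, map_sub, h, sub_self]

variable (p) in
/-- The additive map `ℤ/pℤ → ℤ/p²ℤ`: lift to `ℤ/p²ℤ` and multiply by `p`. -/
def mulP : ZMod p →+ ZMod (p ^ 2) where
  toFun a := (p : ZMod (p ^ 2)) * (ZMod.cast a : ZMod (p ^ 2))
  map_zero' := by simp
  map_add' a b := by
    rw [← mul_add]
    exact natCast_p_mul_congr (by rw [map_add, red_cast, red_cast, red_cast])

lemma mulP_red (x : ZMod (p ^ 2)) : mulP p (red p x) = p * x :=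
  natCast_p_mul_congr (by rw [red_cast])

@[simp] lemma red_mulP (a : ZMod p) : red p (mulP p a) = 0 := by
  obtain ⟨x, rfl⟩ := red_surjective a
  rw [mulP_red]; simp

lemma mul_mulP (x : ZMod (p ^ 2)) (a : ZMod p) : x * mulP p a = mulP p (red p x * a) := by
  obtain ⟨y, rfl⟩ := red_surjective a
  rw [← map_mul, mulP_red, mulP_red]; ring

lemma mulP_mul (x : ZMod (p ^ 2)) (a : ZMod p) : mulP p a * x = mulP p (a * red p x) := by
  rw [mul_comm, mul_mulP, mul_comm]

lemma mulP_injective : Function.Injective (mulP p) := by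
  rw [injective_iff_map_eq_zero]
  intro a h
  obtain ⟨x, rfl⟩ := red_surjective a
  rwa [mulP_red, natCast_p_mul_eq_zero_iff] at h

lemma exists_mulP_of_red_eq {x y : ZMod (p ^ 2)} (h : red p x = red p y) :
    ∃ a, x = y + mulP p a := by
  obtain ⟨z, hz⟩ := (red_eq_zero_iff_dvd (x - y)).1 (by rw [map_sub, h, sub_self])
  exact ⟨red p z, by rw [mulP_red, ← hz]; ring⟩

lemma isUnit_of_red_ne_zero {x : ZMod (p ^ 2)} (h : red p x ≠ 0) : IsUnit x := by
  have hx : ((x.val : ℕ) : ZMod (p ^ 2)) = x := ZMod.natCast_zmod_val x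
  rw [← hx, map_natCast, Ne, ZMod.natCast_eq_zero_iff] at h
  rw [← hx, ZMod.isUnit_iff_coprime]
  exact (((Nat.Prime.coprime_iff_not_dvd Fact.out).2 h).pow_left 2).symm

lemma red_ne_zero_of_isUnit {x : ZMod (p ^ 2)} (h : IsUnit x) : red p x ≠ 0 :=
  (h.map (red p)).ne_zero

/-! ### The kernel of reduction -/

lemma reduction_apply (g : GL (Fin 2) (ZMod (p ^ 2))) (i j : Fin 2) :
    (reduction p g) i j = red p (g i j) := rfl

lemma reduction_coe (g : GL (Fin 2) (ZMod (p ^ 2))) :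
    (reduction p g : Matrix (Fin 2) (Fin 2) (ZMod p)) = (g : Matrix _ _ _).map (red p) := rfl

lemma map_mulP_mul_map_mulP (A B : Matrix (Fin 2) (Fin 2) (ZMod p)) :
    A.map (mulP p) * B.map (mulP p) = 0 := by
  ext i j
  simp [Matrix.mul_apply, mul_mulP]

lemma mul_map_mulP (g : Matrix (Fin 2) (Fin 2) (ZMod (p ^ 2)))
    (A : Matrix (Fin 2) (Fin 2) (ZMod p)) :
    g * A.map (mulP p) = (g.map (red p) * A).map (mulP p) := by
  ext i j
  simp [Matrix.mul_apply, mul_mulP]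

lemma map_mulP_mul (g : Matrix (Fin 2) (Fin 2) (ZMod (p ^ 2)))
    (A : Matrix (Fin 2) (Fin 2) (ZMod p)) :
    A.map (mulP p) * g = (A * g.map (red p)).map (mulP p) := by
  ext i j
  simp [Matrix.mul_apply, mulP_mul]

/-- The element `1 + A p` of the kernel of reduction. -/
def kerElt (A : Matrix (Fin 2) (Fin 2) (ZMod p)) : GL (Fin 2) (ZMod (p ^ 2)) where
  val := 1 + A.map (mulP p)
  inv := 1 - A.map (mulP p)
  val_inv := by
    rw [mul_sub, add_mul, add_mul, map_mulP_mul_map_mulP]; simp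
  inv_val := by
    rw [mul_add, sub_mul, sub_mul, map_mulP_mul_map_mulP]; simp

lemma kerElt_coe (A : Matrix (Fin 2) (Fin 2) (ZMod p)) :
    (kerElt A : Matrix (Fin 2) (Fin 2) (ZMod (p ^ 2))) = 1 + A.map (mulP p) := rfl

lemma kerElt_apply (A : Matrix (Fin 2) (Fin 2) (ZMod p)) (i j : Fin 2) :
    kerElt A i j = (1 : Matrix (Fin 2) (Fin 2) (ZMod (p ^ 2))) i j + mulP p (A i j) := rfl

lemma kerElt_zero : kerElt (0 : Matrix (Fin 2) (Fin 2) (ZMod p)) = 1 := by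
  ext i j; simp [kerElt_apply]

lemma kerElt_add (A B : Matrix (Fin 2) (Fin 2) (ZMod p)) :
    kerElt (A + B) = kerElt A * kerElt B := by
  apply Units.ext
  rw [Units.val_mul, kerElt_coe, kerElt_coe, kerElt_coe, add_mul, mul_add, mul_add,
    map_mulP_mul_map_mulP,
    Matrix.map_add _ (map_add _)]
  simp only [one_mul, mul_one, add_zero]
  abel

lemma kerElt_neg (A : Matrix (Fin 2) (Fin 2) (ZMod p)) : kerElt (-A) = (kerElt A)⁻¹ := by
  rw [eq_inv_iff_mul_eq_one, ← kerElt_add, neg_add_cancel, kerElt_zero]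

@[simp] lemma reduction_kerElt (A : Matrix (Fin 2) (Fin 2) (ZMod p)) :
    reduction p (kerElt A) = 1 := by
  ext i j
  rw [reduction_apply, kerElt_apply, map_add, red_mulP, add_zero]
  fin_cases i <;> fin_cases j <;> simp

lemma mul_kerElt_apply (g : GL (Fin 2) (ZMod (p ^ 2))) (A : Matrix (Fin 2) (Fin 2) (ZMod p))
    (i j : Fin 2) : (g * kerElt A) i j =
      g i j + mulP p (((reduction p g).val * A) i j) := by
  rw [Units.val_mul, kerElt_coe, mul_add, mul_one, mul_map_mulP, reduction_coe]
  rfl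

lemma conj_kerElt (g : GL (Fin 2) (ZMod (p ^ 2))) (A : Matrix (Fin 2) (Fin 2) (ZMod p)) :
    g * kerElt A * g⁻¹ = kerElt ((reduction p g).val * A *
      (reduction p g)⁻¹.val) := by
  apply Units.ext
  rw [Units.val_mul, Units.val_mul, kerElt_coe, kerElt_coe, mul_add, mul_one, add_mul, mul_map_mulP,
    map_mulP_mul, Units.mul_inv, ← map_inv, reduction_coe, reduction_coe]

lemma exists_eq_mul_kerElt {g g' : GL (Fin 2) (ZMod (p ^ 2))} (h : reduction p g = reduction p g') :
    ∃ A, g = g' * kerElt A := by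
  have hx : ∀ i j, ∃ a,
      (g'⁻¹ * g) i j = (1 : Matrix (Fin 2) (Fin 2) (ZMod (p ^ 2))) i j + mulP p a := by
    intro i j
    apply exists_mulP_of_red_eq
    rw [← reduction_apply, map_mul, map_inv, h, inv_mul_cancel]
    fin_cases i <;> fin_cases j <;> simp
  choose a ha using hx
  refine ⟨Matrix.of a, ?_⟩
  rw [← inv_mul_eq_iff_eq_mul]
  ext i j
  rw [ha, kerElt_apply]; rfl

lemma timesP_eq (A : Matrix (Fin 2) (Fin 2) (ZMod p)) : timesP A = A.map (mulP p) := by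
  ext i j; rfl

/-- The `A` with `1 + A p` in `H`, a subspace of `M₂(ℤ/pℤ)`. -/
def kerModule (H : Subgroup (GL (Fin 2) (ZMod (p ^ 2)))) :
    Submodule (ZMod p) (Matrix (Fin 2) (Fin 2) (ZMod p)) :=
  AddSubgroup.toZModSubmodule p
    { carrier := {A | kerElt A ∈ H}
      zero_mem' := by simp [kerElt_zero, H.one_mem]
      add_mem' := by
        intro A B hA hB
        change kerElt (A + B) ∈ H
        rw [kerElt_add]
        exact H.mul_mem hA hB
      neg_mem' := by
        intro A hA
        change kerElt (-A) ∈ H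
        rw [kerElt_neg]
        exact H.inv_mem hA }

lemma mem_kerModule {H : Subgroup (GL (Fin 2) (ZMod (p ^ 2)))}
    {A : Matrix (Fin 2) (Fin 2) (ZMod p)} : A ∈ kerModule H ↔ kerElt A ∈ H := Iff.rfl

lemma conj_mem_kerModule {H : Subgroup (GL (Fin 2) (ZMod (p ^ 2)))}
    {A : Matrix (Fin 2) (Fin 2) (ZMod p)} (hA : A ∈ kerModule H) {r : GL (Fin 2) (ZMod p)}
    (hr : r ∈ H.map (reduction p)) : r.val * A * r⁻¹.val ∈ kerModule H := by
  obtain ⟨g, hg, rfl⟩ := hr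
  rw [mem_kerModule, ← conj_kerElt]
  exact H.mul_mem (H.mul_mem hg hA) (H.inv_mem hg)

/-- If `1 + A p` is conjugate to `h`, then `h = 1 + B p` with `B` similar to `A`. -/
lemma exists_kerElt_of_isConj {A : Matrix (Fin 2) (Fin 2) (ZMod p)} {h : GL (Fin 2) (ZMod (p ^ 2))}
    (hc : IsConj (kerElt A) h) : ∃ r : GL (Fin 2) (ZMod p), h =
      kerElt (r.val * A * r⁻¹.val) := by
  obtain ⟨g, rfl⟩ := isConj_iff.1 hc
  exact ⟨_, conj_kerElt g A⟩

/-! ### Lifts of the unipotent matrix -/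

/-- The matrix with rows `(1, x)` and `(0, 1)`. -/
def upperGL {S : Type*} [CommRing S] (x : S) : GL (Fin 2) S where
  val := !![1, x; 0, 1]
  inv := !![1, -x; 0, 1]
  val_inv := by simp [Matrix.one_fin_two]
  inv_val := by simp [Matrix.one_fin_two]

/-- The matrix with rows `(1, 0)` and `(x, 1)`. -/
def lowerGL {S : Type*} [CommRing S] (x : S) : GL (Fin 2) S where
  val := !![1, 0; x, 1]
  inv := !![1, 0; -x, 1]
  val_inv := by simp [Matrix.one_fin_two]
  inv_val := by simp [Matrix.one_fin_two]

section
variable {S : Type*} [CommRing S]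

lemma upperGL_one : upperGL (1 : S) = unipotent S := rfl

lemma upperGL_mul (x y : S) : upperGL x * upperGL y = upperGL (x + y) := by
  ext i j
  fin_cases i <;> fin_cases j <;> simp [upperGL, add_comm]

lemma upperGL_pow (x : S) (n : ℕ) : upperGL x ^ n = upperGL (n * x) := by
  induction n with
  | zero => ext i j; fin_cases i <;> fin_cases j <;> simp [upperGL]
  | succ n ih => rw [pow_succ, ih, upperGL_mul]; push_cast; ring_nf

lemma lowerGL_mul (x y : S) : lowerGL x * lowerGL y = lowerGL (x + y) := by
  ext i j
  fin_cases i <;> fin_cases j <;> simp [lowerGL]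

lemma unipotent_pow (n : ℕ) : unipotent S ^ n = upperGL (n : S) := by
  rw [← upperGL_one, upperGL_pow, mul_one]

lemma unipotent_coe : (unipotent S).val = !![1, 1; 0, 1] := rfl
lemma upperGL_coe (x : S) : (upperGL x).val = !![1, x; 0, 1] := rfl
lemma upperGL_inv_coe (x : S) : (upperGL x)⁻¹.val = !![1, -x; 0, 1] := rfl
lemma lowerGL_coe (x : S) : (lowerGL x).val = !![1, 0; x, 1] := rfl
lemma diagGL_coe (w z : Sˣ) : (diagGL w z).val = !![(w : S), 0; 0, (z : S)] := rfl
lemma diagGL_inv_coe (w z : Sˣ) :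
    (diagGL w z)⁻¹.val = !![((w⁻¹ : Sˣ) : S), 0; 0, ((z⁻¹ : Sˣ) : S)] := rfl

end

lemma reduction_upperGL (x : ZMod (p ^ 2)) : reduction p (upperGL x) = upperGL (red p x) := by
  ext i j
  rw [reduction_apply]
  fin_cases i <;> fin_cases j <;> simp [upperGL]

lemma reduction_lowerGL (x : ZMod (p ^ 2)) : reduction p (lowerGL x) = lowerGL (red p x) := by
  ext i j
  rw [reduction_apply]
  fin_cases i <;> fin_cases j <;> simp [lowerGL]

lemma upperGL_mem_of_unipotent_mem {J : Subgroup (GL (Fin 2) (ZMod p))}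
    (hu : unipotent (ZMod p) ∈ J) (x : ZMod p) : upperGL x ∈ J := by
  have := J.pow_mem hu x.val
  rwa [unipotent_pow, ZMod.natCast_zmod_val] at this

/-- Powers of a matrix congruent to the unipotent one, entry by entry. -/
lemma pow_entries {τ : GL (Fin 2) (ZMod (p ^ 2))} {a b c d : ZMod p}
    (h : τ.val = !![1 + mulP p a, 1 + mulP p b; mulP p c, 1 + mulP p d]) (n : ℕ) :
    (τ ^ n).val = !![1 + mulP p (n * a + n.choose 2 * c),
        n + mulP p (n * b + n.choose 2 * (a + d) + n.choose 3 * c);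
        mulP p (n * c), 1 + mulP p (n * d + n.choose 2 * c)] := by
  induction n with
  | zero => ext i j; fin_cases i <;> fin_cases j <;> simp
  | succ n ih =>
    rw [pow_succ τ n, Units.val_mul, ih, h]
    have h2 : (((n + 1).choose 2 : ℕ) : ZMod p) = n + (n.choose 2 : ℕ) := by
      rw [Nat.choose_succ_succ' n 1, Nat.choose_one_right, Nat.cast_add]
    have h3 : (((n + 1).choose 3 : ℕ) : ZMod p) = (n.choose 2 : ℕ) + (n.choose 3 : ℕ) := by
      rw [Nat.choose_succ_succ' n 2, Nat.cast_add]
    rw [h2, h3]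
    ext i j
    fin_cases i <;> fin_cases j <;>
    simp [mul_add, add_mul, mul_mulP] <;> abel

lemma exists_entries {τ : GL (Fin 2) (ZMod (p ^ 2))} (h : reduction p τ = unipotent (ZMod p)) :
    ∃ a b c d : ZMod p, τ.val = !![1 + mulP p a, 1 + mulP p b; mulP p c, 1 + mulP p d] := by
  have key : ∀ i j, red p (τ i j) = unipotent (ZMod p) i j := fun i j => by rw [← h]; rfl
  obtain ⟨a, ha⟩ := exists_mulP_of_red_eq (x := τ 0 0) (y := 1) (by rw [key]; simp [unipotent])
  obtain ⟨b, hb⟩ := exists_mulP_of_red_eq (x := τ 0 1) (y := 1) (by rw [key]; simp [unipotent])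
  obtain ⟨c, hc⟩ := exists_mulP_of_red_eq (x := τ 1 0) (y := 0) (by rw [key]; simp [unipotent])
  obtain ⟨d, hd⟩ := exists_mulP_of_red_eq (x := τ 1 1) (y := 1) (by rw [key]; simp [unipotent])
  refine ⟨a, b, c, d, ?_⟩
  rw [Matrix.eta_fin_two τ.val, ha, hb, hc, hd, zero_add]

lemma cast_choose_two_self (hp3 : 3 < p) : ((p.choose 2 : ℕ) : ZMod p) = 0 := by
  rw [ZMod.natCast_eq_zero_iff]
  exact (Fact.out : p.Prime).dvd_choose_self (by norm_num) (by omega)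

lemma cast_choose_three_self (hp3 : 3 < p) : ((p.choose 3 : ℕ) : ZMod p) = 0 := by
  rw [ZMod.natCast_eq_zero_iff]
  exact (Fact.out : p.Prime).dvd_choose_self (by norm_num) (by omega)

/-- The `p`-th power of any lift of the unipotent matrix is `1 + E₁₂ p`; this is where `3 < p`
enters. -/
lemma e_mem_kerModule (hp3 : 3 < p) {H : Subgroup (GL (Fin 2) (ZMod (p ^ 2)))}
    (hu : unipotent (ZMod p) ∈ H.map (reduction p)) : !![0, 1; 0, 0] ∈ kerModule H := by
  obtain ⟨τ, hτ, h⟩ := hu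
  obtain ⟨a, b, c, d, h⟩ := exists_entries h
  have key : kerElt !![0, 1; 0, 0] = τ ^ p := by
    apply Units.ext
    rw [pow_entries h p, cast_choose_two_self hp3, cast_choose_three_self hp3]
    have h1 : mulP p 1 = p := by
      have := mulP_red (1 : ZMod (p ^ 2)); simpa using this
    ext i j
    fin_cases i <;> fin_cases j <;> simp [kerElt_coe, h1]
  rw [mem_kerModule, key]
  exact H.pow_mem hτ p

lemma conj_unipotent_mem_kerModule {H : Subgroup (GL (Fin 2) (ZMod (p ^ 2)))}
    (hu : unipotent (ZMod p) ∈ H.map (reduction p)) {B : Matrix (Fin 2) (Fin 2) (ZMod p)}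
    (hB : B ∈ kerModule H) :
    !![B 0 0 + B 1 0, B 0 1 + B 1 1 - B 0 0 - B 1 0; B 1 0, B 1 1 - B 1 0] ∈ kerModule H := by
  have := conj_mem_kerModule hB hu
  convert this using 1
  have h1 : (unipotent (ZMod p))⁻¹.val = !![1, -1; 0, 1] := rfl
  rw [h1, unipotent_coe, Matrix.eta_fin_two B]
  ext i j
  fin_cases i <;> fin_cases j <;> simp
  all_goals ring

/-- Add a multiple of `E₁₂`. -/
lemma mem_kerModule_of_e {H : Subgroup (GL (Fin 2) (ZMod (p ^ 2)))}
    (he : !![0, 1; 0, 0] ∈ kerModule H) {x y z w : ZMod p}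
    (hB : !![x, y; z, w] ∈ kerModule H) (y' : ZMod p) : !![x, y'; z, w] ∈ kerModule H := by
  convert (kerModule H).add_mem hB ((kerModule H).smul_mem (y' - y) he) using 1
  ext i j
  fin_cases i <;> fin_cases j <;> simp

lemma h_mem_kerModule (hp3 : 3 < p) {H : Subgroup (GL (Fin 2) (ZMod (p ^ 2)))}
    (hu : unipotent (ZMod p) ∈ H.map (reduction p)) {B : Matrix (Fin 2) (Fin 2) (ZMod p)}
    (hB : B ∈ kerModule H) (hne : B 1 0 ≠ 0) : !![1, 0; 0, -1] ∈ kerModule H := by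
  have he := e_mem_kerModule hp3 hu
  have h1 := (kerModule H).smul_mem (B 1 0)⁻¹
    ((kerModule H).sub_mem (conj_unipotent_mem_kerModule hu hB) hB)
  refine mem_kerModule_of_e he (y := (B 1 0)⁻¹ * (B 1 1 - B 0 0 - B 1 0)) ?_ _
  convert h1 using 1
  ext i j
  fin_cases i <;> fin_cases j <;> simp [hne]
  ring

/-! ### Subgroups whose reduction is not upper triangular -/

lemma two_ne_zero_of_three_lt (hp3 : 3 < p) : (2 : ZMod p) ≠ 0 := by
  have : ((2 : ℕ) : ZMod p) ≠ 0 := by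
    rw [Ne, ZMod.natCast_eq_zero_iff]
    exact Nat.not_dvd_of_pos_of_lt (by norm_num) (by omega)
  simpa using this

lemma three_ne_zero_of_three_lt (hp3 : 3 < p) : (3 : ZMod p) ≠ 0 := by
  have : ((3 : ℕ) : ZMod p) ≠ 0 := by
    rw [Ne, ZMod.natCast_eq_zero_iff]
    exact Nat.not_dvd_of_pos_of_lt (by norm_num) hp3
  simpa using this

lemma det_kerElt (B : Matrix (Fin 2) (Fin 2) (ZMod p)) :
    (kerElt B).val.det = 1 + mulP p (B 0 0 + B 1 1) := by
  rw [kerElt_coe, Matrix.det_fin_two]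
  simp [mul_mulP, add_mul, mul_add]
  abel

/-- A determinant-one lift of the reduction of a determinant-one element of `H` is in `H`, if
`H` contains all `1 + B p` with `B` of trace zero. -/
lemma mem_of_det_eq_one {H : Subgroup (GL (Fin 2) (ZMod (p ^ 2)))}
    (hsl : ∀ B : Matrix (Fin 2) (Fin 2) (ZMod p), B 0 0 + B 1 1 = 0 → B ∈ kerModule H)
    {g g' : GL (Fin 2) (ZMod (p ^ 2))} (hg : g ∈ H) (h1 : g.val.det = 1) (h1' : g'.val.det = 1)
    (hr : reduction p g = reduction p g') : g' ∈ H := by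
  obtain ⟨B, rfl⟩ := exists_eq_mul_kerElt hr
  rw [Units.val_mul, Matrix.det_mul, h1', one_mul, det_kerElt] at h1
  have hB : B 0 0 + B 1 1 = 0 := by
    apply mulP_injective
    rw [map_zero]
    exact left_eq_add.1 h1.symm
  exact (H.mul_mem_cancel_right (mem_kerModule.1 (hsl B hB))).1 hg

/-- If the reduction of `H` contains the unipotent matrix and is not upper triangular, then `H`
contains the special linear group. -/
lemma mem_of_not_upper (hp3 : 3 < p) {H : Subgroup (GL (Fin 2) (ZMod (p ^ 2)))}
    (hu : unipotent (ZMod p) ∈ H.map (reduction p))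
    (hnb : ∃ g ∈ H, reduction p g 1 0 ≠ 0) {g : GL (Fin 2) (ZMod (p ^ 2))}
    (hg : g.val.det = 1) : g ∈ H := by
  have he := e_mem_kerModule hp3 hu
  -- An element of `H` whose reduction has rows `(0, b)` and `(c, d)`.
  obtain ⟨r, hrH, hr0, hr1⟩ : ∃ r ∈ H, reduction p r 0 0 = 0 ∧ reduction p r 1 0 ≠ 0 := by
    obtain ⟨g, hg, hne⟩ := hnb
    obtain ⟨τ, hτ, hτr⟩ := upperGL_mem_of_unipotent_mem hu
      (-(reduction p g 0 0) / reduction p g 1 0)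
    refine ⟨τ * g, H.mul_mem hτ hg, ?_, ?_⟩
    · rw [map_mul, hτr, Units.val_mul, Matrix.mul_apply, Fin.sum_univ_two, upperGL_coe]
      simp [div_mul_cancel₀ _ hne]
    · rw [map_mul, hτr, Units.val_mul, Matrix.mul_apply, Fin.sum_univ_two, upperGL_coe]
      simpa using hne
  have hrb : reduction p r 0 1 ≠ 0 := by
    intro h0
    have := Matrix.GeneralLinearGroup.det_ne_zero (reduction p r)
    rw [Matrix.det_fin_two, hr0, h0] at this
    simp at this
  set b := reduction p r 0 1
  set c := reduction p r 1 0
  set d := reduction p r 1 1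
  have hrv : (reduction p r).val = !![0, b; c, d] := by
    rw [Matrix.eta_fin_two (reduction p r).val, hr0]
  -- Conjugation by `r` turns upper unipotents into lower ones.
  have hconj : ∀ x, reduction p r * upperGL x = lowerGL (c / b * x) * reduction p r := by
    intro x
    apply Units.ext
    rw [Units.val_mul, Units.val_mul, hrv, upperGL_coe, lowerGL_coe]
    ext i j
    fin_cases i <;> fin_cases j <;> simp
    all_goals field_simp
  have hlow : ∀ y, lowerGL y ∈ H.map (reduction p) := by
    intro y
    have hm := Subgroup.mul_mem _ (Subgroup.mul_mem _ (Subgroup.mem_map_of_mem (reduction p) hrH)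
      (upperGL_mem_of_unipotent_mem hu (b / c * y)))
      (Subgroup.inv_mem _ (Subgroup.mem_map_of_mem (reduction p) hrH))
    rw [hconj, mul_inv_cancel_right] at hm
    convert hm using 2
    field_simp
  have hf : !![0, 0; 1, 0] ∈ kerModule H := by
    have hm := (kerModule H).smul_mem (b / c)
      (conj_mem_kerModule he (Subgroup.mem_map_of_mem (reduction p) hrH))
    have : (reduction p r).val * !![0, 1; 0, 0] =
        (c / b) • !![0, 0; 1, 0] * (reduction p r).val := by
      rw [hrv]
      ext i j
      fin_cases i <;> fin_cases j <;> simp [div_mul_cancel₀ _ hrb]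
    rw [this, mul_assoc, Units.mul_inv, mul_one, smul_smul] at hm
    convert hm using 1
    rw [div_mul_div_cancel₀ hr1, div_self hrb, one_smul]
  have hh := h_mem_kerModule hp3 hu hf (by simp)
  have hsl : ∀ B : Matrix (Fin 2) (Fin 2) (ZMod p), B 0 0 + B 1 1 = 0 → B ∈ kerModule H := by
    intro B hB
    convert (kerModule H).add_mem ((kerModule H).smul_mem (B 0 0) hh) ((kerModule H).add_mem
      ((kerModule H).smul_mem (B 0 1) he) ((kerModule H).smul_mem (B 1 0) hf)) using 1
    ext i j
    fin_cases i <;> fin_cases j <;> simp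
    linear_combination hB
  have h3 := three_ne_zero_of_three_lt hp3
  have h2 := two_ne_zero_of_three_lt hp3
  -- The cube of the unipotent matrix is a commutator modulo `p`.
  have hU3 : upperGL (3 : ZMod (p ^ 2)) ∈ H := by
    obtain ⟨q, hq, hqr⟩ := Subgroup.mul_mem _ (Subgroup.mul_mem _ (hlow (-(1 / 2)))
      (upperGL_mem_of_unipotent_mem hu 1)) (hlow 1)
    obtain ⟨τ, hτ, hτr⟩ := hu
    refine mem_of_det_eq_one hsl (g := q * τ * q⁻¹ * τ⁻¹) (H.mul_mem (H.mul_mem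
      (H.mul_mem hq hτ) (H.inv_mem hq)) (H.inv_mem hτ)) ?_ ?_ ?_
    · have : Matrix.GeneralLinearGroup.det (q * τ * q⁻¹ * τ⁻¹) = 1 := by
        rw [map_mul, map_mul, map_mul, map_inv, map_inv]; simp
      exact congrArg Units.val this
    · rw [upperGL_coe]; simp
    · rw [map_mul, map_mul, map_mul, map_inv, map_inv, hτr, reduction_upperGL, map_ofNat,
        mul_inv_eq_iff_eq_mul, mul_inv_eq_iff_eq_mul, hqr]
      apply Units.ext
      simp only [Units.val_mul, upperGL_coe, lowerGL_coe, unipotent_coe]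
      ext i j
      fin_cases i <;> fin_cases j <;> simp <;> field_simp <;> norm_num
  have hU : ∀ x : ZMod (p ^ 2), upperGL x ∈ H := by
    intro x
    obtain ⟨v, hv⟩ := isUnit_of_red_ne_zero (p := p) (x := 3) (by rwa [map_ofNat])
    have := H.pow_mem hU3 (x * (v⁻¹ : (ZMod (p ^ 2))ˣ)).val
    rwa [upperGL_pow, ZMod.natCast_zmod_val, ← hv, Units.inv_mul_cancel_right] at this
  have hL : ∀ y : ZMod (p ^ 2), lowerGL y ∈ H := by
    intro y
    obtain ⟨x, hx⟩ := red_surjective (b / c * red p y)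
    refine mem_of_det_eq_one hsl (g := r * upperGL x * r⁻¹) (H.mul_mem (H.mul_mem hrH (hU x))
      (H.inv_mem hrH)) ?_ ?_ ?_
    · have : Matrix.GeneralLinearGroup.det (r * upperGL x * r⁻¹) = 1 := by
        rw [map_mul, map_mul, map_inv, mul_right_comm, mul_inv_cancel, one_mul]
        ext
        simp [upperGL_coe]
      exact congrArg Units.val this
    · rw [lowerGL_coe]; simp
    · rw [map_mul, map_mul, map_inv, reduction_upperGL, reduction_lowerGL, hx, hconj,
        mul_inv_cancel_right]
      congr 1
      field_simp
  -- Matrices of determinant one with a unit in the lower left corner.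
  have hunit : ∀ g : GL (Fin 2) (ZMod (p ^ 2)), g.val.det = 1 → red p (g 1 0) ≠ 0 → g ∈ H := by
    intro g hg hne
    obtain ⟨v, hv⟩ := isUnit_of_red_ne_zero hne
    have hv1 : g 1 0 * (v⁻¹ : (ZMod (p ^ 2))ˣ) = 1 := by rw [← hv, Units.mul_inv]
    rw [Matrix.det_fin_two] at hg
    have : g = upperGL ((g 0 0 - 1) * (v⁻¹ : (ZMod (p ^ 2))ˣ)) * lowerGL (g 1 0) *
        upperGL ((g 1 1 - 1) * (v⁻¹ : (ZMod (p ^ 2))ˣ)) := by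
      apply Units.ext
      simp only [Units.val_mul, upperGL_coe, lowerGL_coe]
      set t : ZMod (p ^ 2) := ((v⁻¹ : (ZMod (p ^ 2))ˣ) : ZMod (p ^ 2))
      ext i j
      fin_cases i <;> fin_cases j <;> simp
      · linear_combination -(g 0 0 - 1) * hv1
      · linear_combination -(g 0 0 - 1) * t * (g 1 1 - 1) * hv1 - t * hg - g 0 1 * hv1
      · linear_combination -(g 1 1 - 1) * hv1
    rw [this]
    exact H.mul_mem (H.mul_mem (hU _) (hL _)) (hU _)
  by_cases hne : red p (g 1 0) = 0
  · have hne2 : red p (g 0 0) ≠ 0 := by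
      intro h0
      have := congrArg (red p) hg
      rw [Matrix.det_fin_two, map_sub, map_mul, map_mul, hne, h0] at this
      simp at this
    refine (H.mul_mem_cancel_left (hL 1)).1 (hunit _ ?_ ?_)
    · rw [Units.val_mul, Matrix.det_mul, hg, lowerGL_coe]; simp
    · rw [Units.val_mul, lowerGL_coe, Matrix.mul_apply, Fin.sum_univ_two]
      simpa [hne] using hne2
  · exact hunit g hg hne

/-! ### Subgroups meeting the same conjugacy classes -/

section Group

variable {G : Type*} [Group G]

/-- Every element of either subgroup is conjugate in `G` to an element of the other one. This
weakening of local conjugacy is all that the classification uses. -/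
def SameClasses (H₁ H₂ : Subgroup G) : Prop :=
  (∀ h ∈ H₁, ∃ h' ∈ H₂, IsConj h h') ∧ ∀ h ∈ H₂, ∃ h' ∈ H₁, IsConj h h'

lemma LocallyConjugate.sameClasses {H₁ H₂ : Subgroup G} (h : LocallyConjugate H₁ H₂) :
    SameClasses H₁ H₂ := by
  obtain ⟨f, hf⟩ := h
  refine ⟨fun x hx => ⟨_, (f ⟨x, hx⟩).2, hf ⟨x, hx⟩⟩, fun x hx => ⟨_, (f.symm ⟨x, hx⟩).2, ?_⟩⟩
  have := hf (f.symm ⟨x, hx⟩)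
  rw [Equiv.apply_symm_apply] at this
  exact this.symm

lemma SameClasses.symm {H₁ H₂ : Subgroup G} (h : SameClasses H₁ H₂) : SameClasses H₂ H₁ :=
  ⟨h.2, h.1⟩

lemma mem_map_conj {H : Subgroup G} {g x : G} :
    x ∈ H.map (MulAut.conj g).toMonoidHom ↔ g⁻¹ * x * g ∈ H := by
  constructor
  · rintro ⟨y, hy, rfl⟩
    simpa [mul_assoc] using hy
  · intro h
    exact ⟨_, h, by simp [mul_assoc]⟩

lemma conj_mem_map_conj {H : Subgroup G} {x : G} (hx : x ∈ H) (g : G) :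
    g * x * g⁻¹ ∈ H.map (MulAut.conj g).toMonoidHom := by
  rw [mem_map_conj]; simpa [mul_assoc] using hx

lemma ConjugateSubgroups.refl (H : Subgroup G) : ConjugateSubgroups H H :=
  ⟨1, by ext x; rw [mem_map_conj]; simp⟩

lemma conjugateSubgroups_map (H : Subgroup G) (g : G) :
    ConjugateSubgroups H (H.map (MulAut.conj g).toMonoidHom) := ⟨g, rfl⟩

lemma ConjugateSubgroups.trans {H₁ H₂ H₃ : Subgroup G} (h : ConjugateSubgroups H₁ H₂)
    (h' : ConjugateSubgroups H₂ H₃) : ConjugateSubgroups H₁ H₃ := by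
  obtain ⟨g, rfl⟩ := h
  obtain ⟨g', rfl⟩ := h'
  refine ⟨g' * g, ?_⟩
  ext x
  simp only [mem_map_conj]
  simp [mul_assoc]

lemma ConjugateSubgroups.symm {H₁ H₂ : Subgroup G} (h : ConjugateSubgroups H₁ H₂) :
    ConjugateSubgroups H₂ H₁ := by
  obtain ⟨g, rfl⟩ := h
  refine ⟨g⁻¹, ?_⟩
  ext x
  simp only [mem_map_conj]
  simp [mul_assoc]

lemma ConjugateSubgroups.sameClasses {H₁ H₂ : Subgroup G} (h : ConjugateSubgroups H₁ H₂) :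
    SameClasses H₁ H₂ := by
  obtain ⟨g, rfl⟩ := h
  refine ⟨fun x hx => ⟨_, conj_mem_map_conj hx g, isConj_iff.2 ⟨g, rfl⟩⟩, fun x hx => ?_⟩
  exact ⟨_, mem_map_conj.1 hx, isConj_iff.2 ⟨g⁻¹, by simp⟩⟩

lemma SameClasses.trans {H₁ H₂ H₃ : Subgroup G} (h : SameClasses H₁ H₂)
    (h' : SameClasses H₂ H₃) : SameClasses H₁ H₃ := by
  refine ⟨fun x hx => ?_, fun x hx => ?_⟩
  · obtain ⟨y, hy, hxy⟩ := h.1 x hx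
    obtain ⟨z, hz, hyz⟩ := h'.1 y hy
    exact ⟨z, hz, hxy.trans hyz⟩
  · obtain ⟨y, hy, hxy⟩ := h'.2 x hx
    obtain ⟨z, hz, hyz⟩ := h.2 y hy
    exact ⟨z, hz, hxy.trans hyz⟩

lemma SameClasses.of_conj {H₁ H₂ K₁ K₂ : Subgroup G} (h : SameClasses H₁ H₂)
    (h₁ : ConjugateSubgroups H₁ K₁) (h₂ : ConjugateSubgroups H₂ K₂) : SameClasses K₁ K₂ :=
  (h₁.symm.sameClasses.trans h).trans h₂.sameClasses

lemma le_or_le_of_forall_mem_or {H K L : Subgroup G} (h : ∀ x ∈ H, x ∈ K ∨ x ∈ L) :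
    H ≤ K ∨ H ≤ L := by
  by_contra! hn
  obtain ⟨⟨x, hx, hxK⟩, ⟨y, hy, hyL⟩⟩ :=
    And.intro (SetLike.not_le_iff_exists.1 hn.1) (SetLike.not_le_iff_exists.1 hn.2)
  have hxL := (h x hx).resolve_left hxK
  have hyK := (h y hy).resolve_right hyL
  rcases h _ (H.mul_mem hx hy) with h1 | h1
  · exact hxK ((K.mul_mem_cancel_right hyK).1 h1)
  · exact hyL ((L.mul_mem_cancel_left hxL).1 h1)

end Group

section Invariants

variable {S : Type*} [CommRing S]

lemma trace_eq_of_isConj {g g' : GL (Fin 2) S} (h : IsConj g g') :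
    g 0 0 + g 1 1 = g' 0 0 + g' 1 1 := by
  obtain ⟨c, rfl⟩ := isConj_iff.1 h
  have := Matrix.trace_units_conj c g.val
  rw [Matrix.trace_fin_two, Matrix.trace_fin_two] at this
  rw [← this]; rfl

lemma det_eq_of_isConj {g g' : GL (Fin 2) S} (h : IsConj g g') :
    g 0 0 * g 1 1 - g 0 1 * g 1 0 = g' 0 0 * g' 1 1 - g' 0 1 * g' 1 0 := by
  obtain ⟨c, rfl⟩ := isConj_iff.1 h
  have := Matrix.det_units_conj c g.val
  rw [Matrix.det_fin_two, Matrix.det_fin_two] at this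
  rw [← this]; rfl

end Invariants

lemma isSquare_of_forall_isSquare_add {t : ZMod p} (ht : t ≠ 0)
    (h : ∀ x : ZMod p, IsSquare x → IsSquare (x + t)) (x : ZMod p) : IsSquare x := by
  have key : ∀ n : ℕ, IsSquare ((n : ZMod p) * t) := by
    intro n
    induction n with
    | zero => simp
    | succ n ih =>
      convert h _ ih using 1
      push_cast; ring
  have := key (x / t).val
  rwa [ZMod.natCast_zmod_val, div_mul_cancel₀ _ ht] at this

/-- If `t² - 4` were always a square, the squares would be stable under translation by `-4`. -/
lemma exists_not_isSquare_sq_sub_four (hp3 : 3 < p) {ε : ZMod p} (hε : ¬ IsSquare ε) :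
    ∃ t : ZMod p, ¬ IsSquare (t * t - 4) := by
  by_contra! h
  have h4 : (-4 : ZMod p) ≠ 0 := by
    have h2 := two_ne_zero_of_three_lt hp3
    rw [show (-4 : ZMod p) = -(2 * 2) by norm_num]
    exact neg_ne_zero.2 (mul_ne_zero h2 h2)
  refine hε (isSquare_of_forall_isSquare_add h4 ?_ ε)
  rintro _ ⟨t, rfl⟩
  rw [← sub_eq_add_neg]
  exact h t

lemma diag_ne_zero_of_lower_eq_zero {r : GL (Fin 2) (ZMod p)} (h : r 1 0 = 0) :
    r 0 0 ≠ 0 ∧ r 1 1 ≠ 0 := by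
  have := Matrix.GeneralLinearGroup.det_ne_zero r
  rw [Matrix.det_fin_two, h, mul_zero, sub_zero] at this
  exact mul_ne_zero_iff.1 this

/-- Subgroups that meet the same classes and contain the special linear group are equal. -/
lemma eq_of_not_upper (hp3 : 3 < p) {ε : ZMod p} (hε : ¬ IsSquare ε)
    {H₁ H₂ : Subgroup (GL (Fin 2) (ZMod (p ^ 2)))} (hH : SameClasses H₁ H₂)
    (h₁ : unipotent (ZMod p) ∈ H₁.map (reduction p))
    (h₂ : unipotent (ZMod p) ∈ H₂.map (reduction p))
    (hnb : ∃ g ∈ H₁, reduction p g 1 0 ≠ 0) : H₁ = H₂ := by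
  have hs1 := fun g => mem_of_not_upper hp3 h₁ hnb (g := g)
  have hnb2 : ∃ g ∈ H₂, reduction p g 1 0 ≠ 0 := by
    obtain ⟨t, ht⟩ := exists_not_isSquare_sq_sub_four hp3 hε
    obtain ⟨s, rfl⟩ := red_surjective t
    have hdet : (!![0, -1; 1, s] : Matrix (Fin 2) (Fin 2) (ZMod (p ^ 2))).det = 1 := by
      simp [Matrix.det_fin_two]
    obtain ⟨x, hx⟩ : ∃ x : GL (Fin 2) (ZMod (p ^ 2)), x.val = !![0, -1; 1, s] :=
      ⟨Matrix.GeneralLinearGroup.mk'' _ (by rw [hdet]; exact isUnit_one), rfl⟩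
    obtain ⟨g, hg, hc⟩ := hH.1 x (hs1 _ (by rw [hx, hdet]))
    refine ⟨g, hg, fun h0 => ht ?_⟩
    have htr := trace_eq_of_isConj ((reduction p).map_isConj hc)
    have hde := det_eq_of_isConj ((reduction p).map_isConj hc)
    rw [h0] at hde
    simp only [reduction_apply, hx] at htr hde
    simp at htr hde
    refine ⟨red p (g 0 0) - red p (g 1 1), ?_⟩
    rw [htr]
    linear_combination (-4) * hde
  have hs2 := fun g => mem_of_not_upper hp3 h₂ hnb2 (g := g)
  have key : ∀ {K₁ K₂ : Subgroup (GL (Fin 2) (ZMod (p ^ 2)))},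
      (∀ g ∈ K₁, ∃ g' ∈ K₂, IsConj g g') → (∀ g, g.val.det = 1 → g ∈ K₂) → K₁ ≤ K₂ := by
    intro K₁ K₂ hK hs g hg
    obtain ⟨g', hg', hc⟩ := hK g hg
    obtain ⟨c, rfl⟩ := isConj_iff.1 hc
    refine (K₂.mul_mem_cancel_right (K₂.inv_mem hg')).1 (hs _ ?_)
    have : Matrix.GeneralLinearGroup.det (g * (c * g * c⁻¹)⁻¹) = 1 := by
      simp only [map_mul, map_inv]
      rw [mul_right_comm, mul_inv_cancel, one_mul, mul_inv_cancel]
    exact congrArg Units.val this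
  exact le_antisymm (key hH.1 hs2) (key hH.2 hs1)

/-! ### Graded subgroups -/

/-- The reduction of `H` is upper triangular, every diagonal matrix in the reduction of `H` lifts
to a diagonal matrix in `H`, and the space of `A` with `1 + A p ∈ H` contains `E₂₁` unless it
consists of upper triangular matrices. -/
structure Graded (H : Subgroup (GL (Fin 2) (ZMod (p ^ 2)))) : Prop where
  upper : ∀ g ∈ H, reduction p g 1 0 = 0
  diag : ∀ g ∈ H, reduction p g 0 1 = 0 → ∃ d ∈ H, d ∈ splitCartan (ZMod (p ^ 2)) ∧
    reduction p d = reduction p g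
  f_mem : ∀ B ∈ kerModule H, B 1 0 ≠ 0 → !![0, 0; 1, 0] ∈ kerModule H

lemma mem_splitCartan_iff {g : GL (Fin 2) (ZMod (p ^ 2))} :
    g ∈ splitCartan (ZMod (p ^ 2)) ↔ g 0 1 = 0 ∧ g 1 0 = 0 := by
  constructor
  · rintro ⟨w, z, rfl⟩
    simp [diagGL]
  · rintro ⟨h1, h2⟩
    have hdet : IsUnit g.val.det := (Matrix.isUnit_iff_isUnit_det _).1 g.isUnit
    rw [Matrix.det_fin_two, h1, zero_mul, sub_zero] at hdet
    obtain ⟨⟨w, hw⟩, ⟨z, hz⟩⟩ := IsUnit.mul_iff.1 hdet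
    refine ⟨w, z, ?_⟩
    ext i j
    fin_cases i <;> fin_cases j <;> simp [diagGL, hw, hz, h1, h2]

lemma exists_mul_pow_diag {τ g : GL (Fin 2) (ZMod (p ^ 2))}
    (hτ : reduction p τ = unipotent (ZMod p)) (hg : reduction p g 1 0 = 0) :
    ∃ n : ℕ, reduction p (g * τ ^ n) 0 1 = 0 := by
  refine ⟨(-(reduction p g 0 1) / reduction p g 0 0).val, ?_⟩
  have h0 := (diag_ne_zero_of_lower_eq_zero hg).1
  rw [map_mul, map_pow, hτ, unipotent_pow, Units.val_mul, Matrix.mul_apply, Fin.sum_univ_two,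
    upperGL_coe]
  simp only [Matrix.of_apply, Matrix.cons_val', Matrix.cons_val_one, Matrix.cons_val_zero,
    Matrix.cons_val_fin_one, mul_one, ZMod.natCast_val, ZMod.cast_id', id_eq]
  field_simp
  ring

section
variable {H : Subgroup (GL (Fin 2) (ZMod (p ^ 2)))}

lemma Graded.diag_mem (hG : Graded H) (he : !![0, 1; 0, 0] ∈ kerModule H)
    {B : Matrix (Fin 2) (Fin 2) (ZMod p)} (hB : B ∈ kerModule H) :
    !![B 0 0, 0; 0, B 1 1] ∈ kerModule H := by
  have h1 : (B 1 0) • !![0, 0; 1, 0] ∈ kerModule H := by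
    by_cases h : B 1 0 = 0
    · rw [h, zero_smul]; exact (kerModule H).zero_mem
    · exact (kerModule H).smul_mem _ (hG.f_mem B hB h)
  convert (kerModule H).sub_mem ((kerModule H).sub_mem hB ((kerModule H).smul_mem (B 0 1) he)) h1
    using 1
  ext i j
  fin_cases i <;> fin_cases j <;> simp

/-- A graded subgroup is generated by a lift of the unipotent matrix, its diagonal matrices and
possibly `1 + E₂₁ p`. -/
lemma Graded.eq_generated (hp3 : 3 < p) (hG : Graded H) {τ k : GL (Fin 2) (ZMod (p ^ 2))}
    (hτH : τ ∈ H) (hτ : reduction p τ = unipotent (ZMod p)) (hk : k ∈ H)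
    (hk' : !![0, 0; 1, 0] ∈ kerModule H → k = kerElt !![0, 0; 1, 0]) :
    H = generated τ k (H ⊓ splitCartan (ZMod (p ^ 2))) := by
  set K := generated τ k (H ⊓ splitCartan (ZMod (p ^ 2))) with hK
  have hτK : τ ∈ K := Subgroup.subset_closure (by simp)
  have hkK : k ∈ K := Subgroup.subset_closure (by simp)
  have hDK : H ⊓ splitCartan (ZMod (p ^ 2)) ≤ K := fun x hx => Subgroup.subset_closure (Or.inr hx)
  apply le_antisymm
  · intro g hg
    obtain ⟨n, hn⟩ := exists_mul_pow_diag hτ (hG.upper g hg)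
    have hgn : g * τ ^ n ∈ H := H.mul_mem hg (H.pow_mem hτH n)
    refine (K.mul_mem_cancel_right (K.pow_mem hτK n)).1 ?_
    obtain ⟨d, hdH, hdC, hdr⟩ := hG.diag _ hgn hn
    obtain ⟨B, hB⟩ := exists_eq_mul_kerElt hdr.symm
    rw [hB] at hgn ⊢
    have hBH : B ∈ kerModule H := (H.mul_mem_cancel_left hdH).1 hgn
    refine K.mul_mem (hDK (Subgroup.mem_inf.2 ⟨hdH, hdC⟩)) ?_
    have heH := e_mem_kerModule hp3 ⟨τ, hτH, hτ⟩
    have heK := e_mem_kerModule hp3 ⟨τ, hτK, hτ⟩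
    have hdK : !![B 0 0, 0; 0, B 1 1] ∈ kerModule K := by
      refine hDK (Subgroup.mem_inf.2 ⟨hG.diag_mem heH hBH, ?_⟩)
      rw [mem_splitCartan_iff]
      simp [kerElt_apply]
    have hfK : (B 1 0) • !![0, 0; 1, 0] ∈ kerModule K := by
      by_cases h : B 1 0 = 0
      · rw [h, zero_smul]; exact (kerModule K).zero_mem
      · refine (kerModule K).smul_mem _ ?_
        rwa [mem_kerModule, ← hk' (hG.f_mem B hBH h)]
    change B ∈ kerModule K
    convert (kerModule K).add_mem ((kerModule K).add_mem hdK ((kerModule K).smul_mem (B 0 1) heK))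
      hfK using 1
    ext i j
    fin_cases i <;> fin_cases j <;> simp
  · rw [hK, generated, Subgroup.closure_le]
    rintro x ((rfl | rfl) | hx)
    · exact hτH
    · exact hk
    · exact hx.1

/-- A diagonal matrix that is conjugate to an element of a graded subgroup lies in it, possibly
after its entries are swapped. -/
lemma Graded.diagGL_mem_or (hp3 : 3 < p) (hG : Graded H)
    (hu : unipotent (ZMod p) ∈ H.map (reduction p)) {w z : (ZMod (p ^ 2))ˣ}
    {g : GL (Fin 2) (ZMod (p ^ 2))} (hg : g ∈ H) (hc : IsConj (diagGL w z) g) :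
    diagGL w z ∈ H ∨ diagGL z w ∈ H := by
  have he := e_mem_kerModule hp3 hu
  obtain ⟨τ, hτH, hτ⟩ := hu
  by_cases hwz : red p w = red p z
  · -- The matrix is a scalar times an element of the kernel of reduction.
    obtain ⟨b, hb⟩ := exists_mulP_of_red_eq hwz.symm
    have hw0 := red_ne_zero_of_isUnit w.isUnit
    set y := b / red p w
    have hby : red p w * y = b := mul_div_cancel₀ _ hw0
    have hd1 : diagGL w z = diagGL w w * kerElt !![0, 0; 0, y] := by
      ext i j
      rw [mul_kerElt_apply, Matrix.mul_apply, Fin.sum_univ_two]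
      simp only [reduction_apply, diagGL_coe]
      fin_cases i <;> fin_cases j <;> simp [hb, hby]
    have hd2 : diagGL z w = diagGL w w * kerElt !![y, 0; 0, 0] := by
      ext i j
      rw [mul_kerElt_apply, Matrix.mul_apply, Fin.sum_univ_two]
      simp only [reduction_apply, diagGL_coe]
      fin_cases i <;> fin_cases j <;> simp [hb, hby]
    have hcen : ∀ x : GL (Fin 2) (ZMod (p ^ 2)), x * diagGL w w = diagGL w w * x := by
      intro x
      ext i j
      rw [Units.val_mul, Units.val_mul, diagGL_coe, Matrix.eta_fin_two x.val]
      fin_cases i <;> fin_cases j <;> simp [mul_comm]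
    obtain ⟨A, hgA, htr, hdet⟩ : ∃ A : Matrix (Fin 2) (Fin 2) (ZMod p),
        g = diagGL w w * kerElt A ∧ A 0 0 + A 1 1 = y ∧ A 0 0 * A 1 1 - A 0 1 * A 1 0 = 0 := by
      obtain ⟨x, rfl⟩ := isConj_iff.1 hc
      refine ⟨(reduction p x).val * !![0, 0; 0, y] * (reduction p x)⁻¹.val, ?_, ?_, ?_⟩
      rotate_left 1
      · have := Matrix.trace_units_conj (reduction p x) !![0, 0; 0, y]
        rw [Matrix.trace_fin_two, Matrix.trace_fin_two] at this
        simpa using this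
      · have := Matrix.det_units_conj (reduction p x) !![0, 0; 0, y]
        rw [Matrix.det_fin_two, Matrix.det_fin_two] at this
        simpa using this
      · rw [hd1, ← mul_assoc, hcen, mul_assoc, mul_assoc, ← conj_kerElt, mul_assoc]
    have hgr : reduction p g = reduction p (diagGL w w) := by
      rw [hgA, map_mul, reduction_kerElt, mul_one]
    obtain ⟨d, hdH, hdC, hdr⟩ := hG.diag g hg (by
      rw [hgr, reduction_apply]; simp [diagGL_coe])
    obtain ⟨A', hA'⟩ := exists_eq_mul_kerElt (hdr.trans hgr)
    have hA'd : A' 0 1 = 0 ∧ A' 1 0 = 0 := by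
      rw [mem_splitCartan_iff, hA', mul_kerElt_apply, mul_kerElt_apply,
        Matrix.mul_apply, Matrix.mul_apply, Fin.sum_univ_two, Fin.sum_univ_two] at hdC
      simp only [reduction_apply, diagGL_coe] at hdC
      simpa [map_eq_zero_iff _ mulP_injective, hw0] using hdC
    have hB : A - A' ∈ kerModule H := by
      rw [mem_kerModule, sub_eq_add_neg, kerElt_add, kerElt_neg]
      have := H.mul_mem (H.inv_mem hdH) hg
      rw [hA', hgA, mul_inv_rev, mul_assoc, inv_mul_cancel_left] at this
      rw [← kerElt_neg, ← kerElt_add] at this ⊢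
      rwa [add_comm]
    have hA1 : ∀ X, X - A' ∈ kerModule H → diagGL w w * kerElt X ∈ H := by
      intro X hX
      have := H.mul_mem hdH hX
      rwa [hA', mul_assoc, ← kerElt_add, add_sub_cancel] at this
    have hdiag := hG.diag_mem he hB
    rw [Matrix.sub_apply, Matrix.sub_apply] at hdiag
    by_cases hA10 : A 1 0 = 0
    · rw [hA10, mul_zero, sub_zero, mul_eq_zero] at hdet
      rcases hdet with h0 | h0
      · left
        rw [hd1]
        apply hA1
        convert hdiag using 1
        ext i j
        fin_cases i <;> fin_cases j <;> simp [hA'd, h0, ← htr]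
      · right
        rw [hd2]
        apply hA1
        convert hdiag using 1
        ext i j
        fin_cases i <;> fin_cases j <;> simp [hA'd, h0, ← htr]
    · left
      have hh := h_mem_kerModule hp3 ⟨τ, hτH, hτ⟩ hB (by simpa [hA'd] using hA10)
      rw [hd1]
      apply hA1
      convert (kerModule H).sub_mem hdiag ((kerModule H).smul_mem (A 0 0) hh) using 1
      ext i j
      fin_cases i <;> fin_cases j <;> simp [hA'd, ← htr]
      ring
  · -- The eigenvalues are distinct modulo `p`, and determine the matrix up to order.
    have hup := hG.upper g hg
    have htr := trace_eq_of_isConj ((reduction p).map_isConj hc)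
    have hde := det_eq_of_isConj ((reduction p).map_isConj hc)
    rw [hup] at hde
    simp only [reduction_apply, diagGL_coe] at htr hde
    simp at htr hde
    have hne : red p (g 0 0) - red p (g 1 1) ≠ 0 := by
      intro h0
      apply hwz
      rw [← sub_eq_zero, ← sq_eq_zero_iff]
      linear_combination (red p w + red p z + red p (g 0 0) + red p (g 1 1)) * htr - 4 * hde +
        (red p (g 0 0) - red p (g 1 1)) * h0
    set n := (red p (g 0 1) / (red p (g 0 0) - red p (g 1 1))).val with hn
    obtain ⟨g', hg', hc', hoff⟩ : ∃ g' ∈ H, IsConj (diagGL w z) g' ∧ reduction p g' 0 1 = 0 := by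
      refine ⟨τ ^ n * g * (τ ^ n)⁻¹, H.mul_mem (H.mul_mem (H.pow_mem hτH n) hg)
        (H.inv_mem (H.pow_mem hτH n)), hc.trans (isConj_iff.2 ⟨_, rfl⟩), ?_⟩
      rw [map_mul, map_mul, map_inv, map_pow, hτ, unipotent_pow, Units.val_mul, Units.val_mul,
        Matrix.eta_fin_two (reduction p g).val, hup, upperGL_inv_coe, upperGL_coe]
      simp only [hn, ZMod.natCast_zmod_val, reduction_apply]
      simp
      field_simp
      ring
    have hup' := hG.upper g' hg'
    obtain ⟨d, hdH, hdC, hdr⟩ := hG.diag g' hg' hoff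
    obtain ⟨B, hB⟩ := exists_eq_mul_kerElt hdr.symm
    have hBH : B ∈ kerModule H := by
      rw [hB] at hg'
      exact (H.mul_mem_cancel_left hdH).1 hg'
    have hd3 : d * kerElt !![B 0 0, 0; 0, B 1 1] ∈ H := H.mul_mem hdH (hG.diag_mem he hBH)
    rw [mem_splitCartan_iff] at hdC
    -- The diagonal part of `g'` is in `H`.
    have hent : ∀ i j, (d * kerElt !![B 0 0, 0; 0, B 1 1]) i j =
        !![g' 0 0, 0; 0, g' 1 1] i j := by
      intro i j
      rw [hB, mul_kerElt_apply, mul_kerElt_apply, mul_kerElt_apply, Matrix.mul_apply,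
        Matrix.mul_apply, Matrix.mul_apply]
      simp only [Fin.sum_univ_two, hdr, hup', hoff]
      fin_cases i <;> fin_cases j <;> simp [hdC, hup', hoff]
    rw [reduction_apply] at hup' hoff
    obtain ⟨x, hx⟩ := exists_mulP_of_red_eq (hup'.trans (map_zero _).symm)
    obtain ⟨x', hx'⟩ := exists_mulP_of_red_eq (hoff.trans (map_zero _).symm)
    have htr' := trace_eq_of_isConj hc'
    have hde' := det_eq_of_isConj hc'
    rw [hx, hx', zero_add, zero_add, mul_mulP, red_mulP, zero_mul, map_zero, sub_zero] at hde'
    simp only [diagGL_coe] at htr' hde'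
    simp at htr' hde'
    have hprod : ((w : ZMod (p ^ 2)) - g' 0 0) * (w - g' 1 1) = 0 := by
      linear_combination (w : ZMod (p ^ 2)) * htr' - hde'
    by_cases hw : red p w = red p (g' 0 0)
    · left
      have hne : red p ((w : ZMod (p ^ 2)) - g' 1 1) ≠ 0 := by
        intro h0
        apply hwz
        have := congrArg (red p) htr'
        rw [map_add, map_add] at this
        rw [map_sub] at h0
        linear_combination -this + hw + h0
      have h1 : (w : ZMod (p ^ 2)) = g' 0 0 :=
        sub_eq_zero.1 (((isUnit_of_red_ne_zero hne).mul_left_eq_zero).1 hprod)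
      have h2 : (z : ZMod (p ^ 2)) = g' 1 1 := by linear_combination htr' - h1
      convert hd3
      ext i j
      rw [hent, ← h1, ← h2]; rfl
    · right
      have hne : red p ((w : ZMod (p ^ 2)) - g' 0 0) ≠ 0 := by
        rw [map_sub]; exact sub_ne_zero.2 hw
      have h1 : (w : ZMod (p ^ 2)) = g' 1 1 :=
        sub_eq_zero.1 (((isUnit_of_red_ne_zero hne).mul_right_eq_zero).1 hprod)
      have h2 : (z : ZMod (p ^ 2)) = g' 0 0 := by linear_combination htr' - h1
      convert hd3
      ext i j
      rw [hent, ← h1, ← h2]; rfl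

end

/-- `H₁` and `H₂` are conjugate to `⟨τ, k, D⟩` and `⟨τ, k, D'⟩`, in some order, for a listed lift
`τ`, a listed `k` and distinct diagonal swaps `D`, `D'`. -/
def ListedPair (ε : ZMod p) (H₁ H₂ : Subgroup (GL (Fin 2) (ZMod (p ^ 2)))) : Prop :=
  ∃ (τ k : GL (Fin 2) (ZMod (p ^ 2))) (D D' : Subgroup (GL (Fin 2) (ZMod (p ^ 2)))),
    IsListedLift ε τ ∧ IsListedKernelElement k ∧ DiagonalSwaps D D' ∧ D ≠ D' ∧
    ((ConjugateSubgroups H₁ (generated τ k D) ∧ ConjugateSubgroups H₂ (generated τ k D')) ∨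
      (ConjugateSubgroups H₁ (generated τ k D') ∧ ConjugateSubgroups H₂ (generated τ k D)))

lemma ListedPair.of_conj {q : ℕ} {ε : ZMod q}
    {H₁ H₂ K₁ K₂ : Subgroup (GL (Fin 2) (ZMod (q ^ 2)))}
    (h : ListedPair ε K₁ K₂) (h₁ : ConjugateSubgroups H₁ K₁) (h₂ : ConjugateSubgroups H₂ K₂) :
    ListedPair ε H₁ H₂ := by
  obtain ⟨τ, k, D, D', hτ, hk, hD, hne, h⟩ := h
  exact ⟨τ, k, D, D', hτ, hk, hD, hne, h.imp (fun h => ⟨h₁.trans h.1, h₂.trans h.2⟩)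
    (fun h => ⟨h₁.trans h.1, h₂.trans h.2⟩)⟩

lemma IsListedLift.reduction_eq {ε : ZMod p} {τ : GL (Fin 2) (ZMod (p ^ 2))}
    (h : IsListedLift ε τ) : reduction p τ = unipotent (ZMod p) := by
  have key : ∀ A : Matrix (Fin 2) (Fin 2) (ZMod p), τ.val = !![1, 1; 0, 1] + timesP A →
      reduction p τ = unipotent (ZMod p) := by
    intro A hA
    ext i j
    rw [reduction_apply, hA, timesP_eq]
    fin_cases i <;> fin_cases j <;> simp [unipotent]
  rcases h with h | h | ⟨a, h⟩ | ⟨a, h⟩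
  · exact key 0 (by rw [h, timesP_eq]; simp)
  all_goals exact key _ h

section

variable {H₁ H₂ : Subgroup (GL (Fin 2) (ZMod (p ^ 2)))}

lemma SameClasses.exists_mem_kerModule (hH : SameClasses H₁ H₂)
    {A : Matrix (Fin 2) (Fin 2) (ZMod p)} (hA : A ∈ kerModule H₁) :
    ∃ B ∈ kerModule H₂, B 0 0 + B 1 1 = A 0 0 + A 1 1 ∧
      B 0 0 * B 1 1 - B 0 1 * B 1 0 = A 0 0 * A 1 1 - A 0 1 * A 1 0 := by
  obtain ⟨g, hg, hc⟩ := hH.1 _ hA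
  obtain ⟨r, rfl⟩ := exists_kerElt_of_isConj hc
  refine ⟨_, hg, ?_, ?_⟩
  · have := Matrix.trace_units_conj r A
    rwa [Matrix.trace_fin_two, Matrix.trace_fin_two] at this
  · have := Matrix.det_units_conj r A
    rwa [Matrix.det_fin_two, Matrix.det_fin_two] at this

/-- An element `1 + A p` whose `A` has nonsquare discriminant is conjugate only to elements that
are not upper triangular. -/
lemma SameClasses.exists_lower_ne_zero (hH : SameClasses H₁ H₂) {ε : ZMod p}
    (hε : ¬ IsSquare ε) (he : !![0, 1; 0, 0] ∈ kerModule H₁) {a : ZMod p}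
    (ha : !![a, 0; 1, a] ∈ kerModule H₁) :
    ∃ B ∈ kerModule H₂, B 1 0 ≠ 0 ∧ B 0 0 + B 1 1 = 2 * a := by
  obtain ⟨B, hB, htr, hde⟩ := hH.exists_mem_kerModule (mem_kerModule_of_e he ha ε)
  simp at htr hde
  refine ⟨B, hB, fun h0 => hε ⟨B 0 0 - a, ?_⟩, by rw [htr]; ring⟩
  rw [h0] at hde
  linear_combination (-B 0 0) * htr + hde

lemma f_mem_of_sameClasses (hp3 : 3 < p) {ε : ZMod p} (hε : ¬ IsSquare ε) (hG₂ : Graded H₂)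
    (h₁ : unipotent (ZMod p) ∈ H₁.map (reduction p)) (hH : SameClasses H₁ H₂)
    (hf : !![0, 0; 1, 0] ∈ kerModule H₁) : !![0, 0; 1, 0] ∈ kerModule H₂ := by
  obtain ⟨B, hB, hne, -⟩ := hH.exists_lower_ne_zero hε (e_mem_kerModule hp3 h₁) hf
  exact hG₂.f_mem B hB hne

end

/-- The permutation matrix that exchanges the two coordinates. -/
def swapGL (S : Type*) [CommRing S] : GL (Fin 2) S where
  val := !![0, 1; 1, 0]
  inv := !![0, 1; 1, 0]
  val_inv := by simp [Matrix.one_fin_two]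
  inv_val := by simp [Matrix.one_fin_two]

lemma swapGL_conj {S : Type*} [CommRing S] (w z : Sˣ) :
    (swapGL S)⁻¹ * diagGL w z * swapGL S = diagGL z w := by
  have h1 : (swapGL S)⁻¹.val = !![0, 1; 1, 0] := rfl
  have h2 : (swapGL S).val = !![0, 1; 1, 0] := rfl
  apply Units.ext
  rw [Units.val_mul, Units.val_mul, h1, h2, diagGL_coe, diagGL_coe]
  ext i j
  fin_cases i <;> fin_cases j <;> simp

section

variable {H₁ H₂ : Subgroup (GL (Fin 2) (ZMod (p ^ 2)))}

lemma Graded.le_or_le_swap (hp3 : 3 < p) (hG₂ : Graded H₂)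
    (h₂ : unipotent (ZMod p) ∈ H₂.map (reduction p)) (hH : SameClasses H₁ H₂) :
    H₁ ⊓ splitCartan (ZMod (p ^ 2)) ≤ H₂ ⊓ splitCartan (ZMod (p ^ 2)) ∨
      H₁ ⊓ splitCartan (ZMod (p ^ 2)) ≤
        (H₂ ⊓ splitCartan (ZMod (p ^ 2))).map
          (MulAut.conj (swapGL (ZMod (p ^ 2)))).toMonoidHom := by
  apply le_or_le_of_forall_mem_or
  rintro x ⟨hx, w, z, rfl⟩
  obtain ⟨g, hg, hc⟩ := hH.1 _ hx
  refine (hG₂.diagGL_mem_or hp3 h₂ hg hc).imp (fun h => Subgroup.mem_inf.2 ⟨h, w, z, rfl⟩)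
    fun h => ?_
  rw [mem_map_conj, swapGL_conj]
  exact Subgroup.mem_inf.2 ⟨h, z, w, rfl⟩

/-- Distinct graded subgroups with a common lift of the unipotent matrix that meet the same
conjugacy classes differ by a swap of their diagonal parts. -/
lemma Graded.listedPair (hp3 : 3 < p) {ε : ZMod p} (hε : ¬ IsSquare ε) (hG₁ : Graded H₁)
    (hG₂ : Graded H₂) (hH : SameClasses H₁ H₂) (hne : H₁ ≠ H₂) {τ : GL (Fin 2) (ZMod (p ^ 2))}
    (hτ : IsListedLift ε τ) (h₁ : τ ∈ H₁) (h₂ : τ ∈ H₂) : ListedPair ε H₁ H₂ := by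
  have hu₁ : unipotent (ZMod p) ∈ H₁.map (reduction p) := ⟨τ, h₁, hτ.reduction_eq⟩
  have hu₂ : unipotent (ZMod p) ∈ H₂.map (reduction p) := ⟨τ, h₂, hτ.reduction_eq⟩
  have hf : !![0, 0; 1, 0] ∈ kerModule H₁ ↔ !![0, 0; 1, 0] ∈ kerModule H₂ :=
    ⟨f_mem_of_sameClasses hp3 hε hG₂ hu₁ hH, f_mem_of_sameClasses hp3 hε hG₁ hu₂ hH.symm⟩
  obtain ⟨k, hk, hk₁, hk₂, hk'⟩ : ∃ k : GL (Fin 2) (ZMod (p ^ 2)), IsListedKernelElement k ∧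
      k ∈ H₁ ∧ k ∈ H₂ ∧ (!![0, 0; 1, 0] ∈ kerModule H₁ → k = kerElt !![0, 0; 1, 0]) := by
    by_cases h : !![0, 0; 1, 0] ∈ kerModule H₁
    · exact ⟨_, Or.inr (by rw [timesP_eq, kerElt_coe]), h, hf.1 h, fun _ => rfl⟩
    · exact ⟨1, Or.inl rfl, H₁.one_mem, H₂.one_mem, fun h' => absurd h' h⟩
  have hgen₁ := hG₁.eq_generated hp3 h₁ hτ.reduction_eq hk₁ hk'
  have hgen₂ := hG₂.eq_generated hp3 h₂ hτ.reduction_eq hk₂ (fun h => hk' (hf.2 h))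
  set D₁ := H₁ ⊓ splitCartan (ZMod (p ^ 2)) with hD₁
  set D₂ := H₂ ⊓ splitCartan (ZMod (p ^ 2)) with hD₂
  have hDne : D₁ ≠ D₂ := by
    intro h
    apply hne
    rw [hgen₁, hgen₂, h]
  have hcard : ∀ D : Subgroup (GL (Fin 2) (ZMod (p ^ 2))),
      Nat.card (D.map (MulAut.conj (swapGL (ZMod (p ^ 2)))).toMonoidHom) = Nat.card D :=
    fun D => Subgroup.card_map_of_injective (MulAut.conj (swapGL (ZMod (p ^ 2)))).injective
  have heq : D₁ = D₂.map (MulAut.conj (swapGL (ZMod (p ^ 2)))).toMonoidHom := by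
    have hle₁ := hG₂.le_or_le_swap hp3 hu₂ hH
    have hle₂ := hG₁.le_or_le_swap hp3 hu₁ hH.symm
    rw [← hD₁, ← hD₂] at hle₁ hle₂
    have c₁ : ¬ (D₁ ≤ D₂ ∧ Nat.card D₂ ≤ Nat.card D₁) :=
      fun h => hDne (Subgroup.eq_of_le_of_card_ge h.1 h.2)
    have c₂ : ¬ (D₂ ≤ D₁ ∧ Nat.card D₁ ≤ Nat.card D₂) :=
      fun h => hDne (Subgroup.eq_of_le_of_card_ge h.1 h.2).symm
    have hcards : ∀ {D D' : Subgroup (GL (Fin 2) (ZMod (p ^ 2)))}, D ≤ D' →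
        Nat.card D ≤ Nat.card D' := fun h => Subgroup.card_le_of_le h
    rcases hle₁ with h | h
    · rcases hle₂ with h' | h'
      · exact absurd (le_antisymm h h') hDne
      · exact absurd ⟨h, (hcards h').trans (hcard D₁).le⟩ c₁
    · rcases hle₂ with h' | h'
      · exact absurd ⟨h', (hcards h).trans (hcard D₂).le⟩ c₂
      · refine Subgroup.eq_of_le_of_card_ge h ?_
        rw [hcard]
        exact (hcards h').trans (hcard D₁).le
  refine ⟨τ, k, D₁, D₂, hτ, hk, ⟨inf_le_right, inf_le_right, fun w z => ?_⟩, hDne, Or.inl ⟨?_, ?_⟩⟩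
  · rw [heq, mem_map_conj, swapGL_conj]
  · rw [← hgen₁]; exact .refl _
  · rw [← hgen₂]; exact .refl _

end

/-! ### Normalizing lifts of the unipotent matrix -/

lemma two_mul_cast_choose_two {S : Type*} [CommRing S] (n : ℕ) :
    2 * ((n.choose 2 : ℕ) : S) = n * (n - 1) := by
  induction n with
  | zero => simp
  | succ n ih =>
    rw [Nat.choose_succ_succ' n 1, Nat.choose_one_right]
    push_cast
    rw [mul_add, ih]; ring

lemma exists_sq_mul_eq {ε : ZMod p} (hε : ¬ IsSquare ε) (c : ZMod p) :
    ∃ m : ZMod p, m ≠ 0 ∧ (m ^ 2 * c = 0 ∨ m ^ 2 * c = 1 ∨ m ^ 2 * c = ε) := by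
  by_cases hc : c = 0
  · exact ⟨1, one_ne_zero, Or.inl (by rw [hc, mul_zero])⟩
  by_cases hs : IsSquare c
  · obtain ⟨s, rfl⟩ := hs
    have hs0 : s ≠ 0 := fun h => hc (by rw [h, mul_zero])
    exact ⟨s⁻¹, inv_ne_zero hs0, Or.inr (Or.inl (by field_simp))⟩
  · have h1 : IsSquare (ε * c) := by
      by_contra hn
      have h0 : ε * c ≠ 0 := mul_ne_zero (fun h => hε (by rw [h]; exact IsSquare.zero)) hc
      rw [← quadraticChar_neg_one_iff_not_isSquare] at hn hε hs
      rw [map_mul, hε, hs] at hn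
      norm_num at hn
    obtain ⟨s, hs⟩ := h1
    have hs0 : s ≠ 0 := by
      rintro rfl
      rw [mul_zero, mul_eq_zero] at hs
      exact hs.elim (fun h => hε (by rw [h]; exact IsSquare.zero)) hc
    refine ⟨s / c, div_ne_zero hs0 hc, Or.inr (Or.inr ?_)⟩
    field_simp
    rw [pow_two, ← hs, mul_comm]

lemma eq_of_sq_mul_eq {ε : ZMod p} (hε : ¬ IsSquare ε) {c₁ c₂ m : ZMod p} (hm : m ≠ 0)
    (h₁ : c₁ = 0 ∨ c₁ = 1 ∨ c₁ = ε) (h₂ : c₂ = 0 ∨ c₂ = 1 ∨ c₂ = ε) (h : c₁ = m ^ 2 * c₂) :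
    c₁ = c₂ := by
  have hε0 : ε ≠ 0 := fun h => hε (by rw [h]; exact IsSquare.zero)
  have hm2 := pow_ne_zero 2 hm
  rcases h₁ with rfl | rfl | rfl <;> rcases h₂ with rfl | rfl | rfl
  · rfl
  · exact absurd h.symm (mul_ne_zero hm2 one_ne_zero)
  · exact absurd h.symm (mul_ne_zero hm2 hε0)
  · simp at h
  · rfl
  · exact absurd ⟨m⁻¹, by field_simp; rw [mul_comm]; exact h.symm⟩ hε
  · simp [hε0] at h
  · exact absurd ⟨m, by rw [h]; ring⟩ hε
  · rfl

/-- Conjugating a power of a lift of the unipotent matrix by a diagonal matrix multiplies its lower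
left entry by any prescribed nonzero square. -/
lemma exists_scaled_entries {τ : GL (Fin 2) (ZMod (p ^ 2))} {a b c d : ZMod p}
    (h : τ.val = !![1 + mulP p a, 1 + mulP p b; mulP p c, 1 + mulP p d]) {m : ZMod p}
    (hm : m ≠ 0) : ∃ (n : ℕ) (μ : (ZMod (p ^ 2))ˣ) (b' t : ZMod p),
      (diagGL μ 1 * τ ^ n * (diagGL μ 1)⁻¹).val = !![1 + mulP p (m * a + t * c), 1 + mulP p b';
        mulP p (m ^ 2 * c), 1 + mulP p (m * d + t * c)] := by
  obtain ⟨x, hx⟩ := red_surjective m⁻¹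
  obtain ⟨μ, rfl⟩ := isUnit_of_red_ne_zero (x := x) (by rw [hx]; exact inv_ne_zero hm)
  have hμ : red p ((μ⁻¹ : (ZMod (p ^ 2))ˣ) : ZMod (p ^ 2)) = m := by
    have h1 : red p (μ : ZMod (p ^ 2)) * red p ((μ⁻¹ : (ZMod (p ^ 2))ˣ) : ZMod (p ^ 2)) = 1 := by
      rw [← map_mul, Units.mul_inv, map_one]
    rw [hx] at h1
    field_simp at h1
    exact h1
  have hn : ((m.val : ℕ) : ZMod p) = m := ZMod.natCast_zmod_val m
  have hpow := pow_entries h m.val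
  rw [hn] at hpow
  set β := m * b + (m.val.choose 2 : ℕ) * (a + d) + (m.val.choose 3 : ℕ) * c
  obtain ⟨b', hb'⟩ := exists_mulP_of_red_eq (x := (μ : ZMod (p ^ 2)) *
    (((m.val : ℕ) : ZMod (p ^ 2)) + mulP p β))
    (y := 1) (by rw [map_mul, map_add, map_natCast, red_mulP, hn, hx, add_zero,
      inv_mul_cancel₀ hm, map_one])
  refine ⟨m.val, μ, b', (m.val.choose 2 : ℕ), ?_⟩
  rw [Units.val_mul, Units.val_mul, hpow, diagGL_coe, diagGL_inv_coe]
  ext i j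
  fin_cases i <;> fin_cases j
  · simp
    rw [mul_right_comm, Units.mul_inv, one_mul]
  · simpa using hb'
  · simp [mulP_mul, hμ]
    ring_nf
  · simp

lemma reduction_eq_unipotent {τ : GL (Fin 2) (ZMod (p ^ 2))} {a b c d : ZMod p}
    (h : τ.val = !![1 + mulP p a, 1 + mulP p b; mulP p c, 1 + mulP p d]) :
    reduction p τ = unipotent (ZMod p) := by
  ext i j
  rw [reduction_apply, h]
  fin_cases i <;> fin_cases j <;> simp [unipotent]

lemma exists_eq_upperGL_of_isConj {r : GL (Fin 2) (ZMod p)} {m : ZMod p} (hm : m ≠ 0)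
    (h0 : r 1 0 = 0) (hc : IsConj (upperGL m) r) : ∃ n, n ≠ 0 ∧ r = upperGL n := by
  have htr := trace_eq_of_isConj hc
  have hde := det_eq_of_isConj hc
  rw [h0, upperGL_coe] at hde
  rw [upperGL_coe] at htr
  simp at htr hde
  have h00 : r 0 0 = 1 := by
    rw [← sub_eq_zero, ← sq_eq_zero_iff]
    linear_combination (-r 0 0) * htr + hde
  have h11 : r 1 1 = 1 := by linear_combination -htr - h00
  have hr : r = upperGL (r 0 1) := by
    ext i j
    fin_cases i <;> fin_cases j <;> simp [upperGL_coe, h00, h11, h0]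
  refine ⟨r 0 1, fun hz => hm ?_, hr⟩
  have h1 : upperGL (0 : ZMod p) = 1 := by
    ext i j
    fin_cases i <;> fin_cases j <;> simp [upperGL_coe]
  rw [hr, hz, h1, isConj_one_left] at hc
  have : upperGL m 0 1 = (1 : GL (Fin 2) (ZMod p)) 0 1 := by rw [hc]
  simpa [upperGL_coe] using this

/-- For matrices that are upper triangular with equal diagonal entries modulo `p`, conjugation
preserves the product of the two off-diagonal entries, a multiple of `p`. -/
lemma lower_entry_of_isConj (hp3 : 3 < p) {g g' : GL (Fin 2) (ZMod (p ^ 2))} (hc : IsConj g g')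
    {x x' : ZMod p} (hx : g 1 0 = mulP p x) (hx' : g' 1 0 = mulP p x')
    (hd : red p (g 0 0) = red p (g 1 1)) (hd' : red p (g' 0 0) = red p (g' 1 1)) :
    red p (g 0 1) * x = red p (g' 0 1) * x' := by
  have htr := trace_eq_of_isConj hc
  have hde := det_eq_of_isConj hc
  obtain ⟨y, hy⟩ := exists_mulP_of_red_eq hd
  obtain ⟨y', hy'⟩ := exists_mulP_of_red_eq hd'
  have hyy : mulP p y * mulP p y = 0 := by rw [mul_mulP, red_mulP, zero_mul, map_zero]
  have hyy' : mulP p y' * mulP p y' = 0 := by rw [mul_mulP, red_mulP, zero_mul, map_zero]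
  have key : (4 : ZMod (p ^ 2)) * (g 0 1 * g 1 0) = 4 * (g' 0 1 * g' 1 0) := by
    have h1 : (g 0 0 - g 1 1) * (g 0 0 - g 1 1) = 0 := by rw [hy, add_sub_cancel_left, hyy]
    have h2 : (g' 0 0 - g' 1 1) * (g' 0 0 - g' 1 1) = 0 := by rw [hy', add_sub_cancel_left, hyy']
    linear_combination (g 0 0 + g 1 1 + g' 0 0 + g' 1 1) * htr - 4 * hde - h1 + h2
  rw [hx, hx', mul_mulP, mul_mulP, mul_mulP, mul_mulP, map_ofNat] at key
  have h2 := two_ne_zero_of_three_lt hp3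
  have h4 : (4 : ZMod p) ≠ 0 := by
    rw [show (4 : ZMod p) = 2 * 2 by norm_num]; exact mul_ne_zero h2 h2
  exact mul_left_cancel₀ h4 (mulP_injective key)

/-! ### Subgroups with an element of distinct eigenvalues modulo `p` -/

lemma upper_map_conj {H : Subgroup (GL (Fin 2) (ZMod (p ^ 2)))}
    (hup : ∀ g ∈ H, reduction p g 1 0 = 0) {g : GL (Fin 2) (ZMod (p ^ 2))}
    (hg : reduction p g 1 0 = 0) :
    ∀ x ∈ H.map (MulAut.conj g).toMonoidHom, reduction p x 1 0 = 0 := by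
  rintro _ ⟨x, hx, rfl⟩
  have hinv : (reduction p g)⁻¹ 1 0 = 0 := by
    have h1 : (reduction p g * (reduction p g)⁻¹) 1 0 = 0 := by rw [mul_inv_cancel]; simp
    rw [Units.val_mul, Matrix.mul_apply, Fin.sum_univ_two, hg, zero_mul, zero_add,
      mul_eq_zero] at h1
    exact h1.resolve_left (diag_ne_zero_of_lower_eq_zero hg).2
  have h2 : (MulAut.conj g).toMonoidHom x = g * x * g⁻¹ := rfl
  rw [h2, map_mul, map_mul, map_inv, Units.val_mul, Units.val_mul, Matrix.mul_apply,
    Fin.sum_univ_two, Matrix.mul_apply, Matrix.mul_apply, Fin.sum_univ_two, Fin.sum_univ_two,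
    hup x hx, hinv, hg]
  simp

/-- Diagonalization over `ℤ/p²ℤ` of a matrix that is upper triangular with distinct diagonal
entries modulo `p`. -/
lemma exists_conj_mem_splitCartan {h : GL (Fin 2) (ZMod (p ^ 2))} (h0 : reduction p h 1 0 = 0)
    (hne : red p (h 0 0) ≠ red p (h 1 1)) : ∃ (g : GL (Fin 2) (ZMod (p ^ 2))) (s : ZMod p),
      reduction p g = upperGL s ∧ g * h * g⁻¹ ∈ splitCartan (ZMod (p ^ 2)) := by
  obtain ⟨c, hc⟩ := exists_mulP_of_red_eq (x := h 1 0) (y := 0) (by rw [map_zero]; exact h0)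
  rw [zero_add] at hc
  have hne' : red p (h 0 0) - red p (h 1 1) ≠ 0 := sub_ne_zero.2 hne
  set y := c / (red p (h 0 0) - red p (h 1 1))
  have hyc : y * (red p (h 0 0) - red p (h 1 1)) = c := div_mul_cancel₀ _ hne'
  have hLinv : (lowerGL (-mulP p y))⁻¹.val = !![1, 0; mulP p y, 1] := by
    rw [show (lowerGL (-mulP p y))⁻¹.val = !![1, 0; -(-mulP p y), 1] from rfl, neg_neg]
  obtain ⟨k, hk⟩ : ∃ k, lowerGL (-mulP p y) * h * (lowerGL (-mulP p y))⁻¹ = k := ⟨_, rfl⟩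
  have hk00 : k 0 0 = h 0 0 + mulP p (red p (h 0 1) * y) := by
    rw [← hk, Units.val_mul, Units.val_mul, hLinv, lowerGL_coe, Matrix.eta_fin_two h.val]
    simp [mul_mulP]
  have hk10 : k 1 0 = 0 := by
    rw [← hk, Units.val_mul, Units.val_mul, hLinv, lowerGL_coe, Matrix.eta_fin_two h.val, hc]
    simp [mul_mulP, mulP_mul, add_mul]
    rw [← hyc]
    simp only [← map_neg, ← map_add]
    rw [map_eq_zero_iff _ mulP_injective]
    ring
  have hk11 : k 1 1 = h 1 1 - mulP p (y * red p (h 0 1)) := by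
    rw [← hk, Units.val_mul, Units.val_mul, hLinv, lowerGL_coe, Matrix.eta_fin_two h.val, hc]
    simp [mulP_mul]
    ring
  obtain ⟨v, hv⟩ : IsUnit (k 0 0 - k 1 1) := by
    apply isUnit_of_red_ne_zero
    rw [hk00, hk11]
    simpa using hne'
  set x := k 0 1 * ((v⁻¹ : (ZMod (p ^ 2))ˣ) : ZMod (p ^ 2)) with hx
  have hxv : x * (k 0 0 - k 1 1) = k 0 1 := by rw [hx, ← hv, Units.inv_mul_cancel_right]
  refine ⟨upperGL x * lowerGL (-mulP p y), red p x, ?_, ?_⟩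
  · rw [map_mul, reduction_upperGL, reduction_lowerGL, map_neg, red_mulP, neg_zero]
    have : lowerGL (0 : ZMod p) = 1 := by
      ext i j; fin_cases i <;> fin_cases j <;> simp [lowerGL]
    rw [this, mul_one]
  · have : upperGL x * lowerGL (-mulP p y) * h * (upperGL x * lowerGL (-mulP p y))⁻¹ =
        upperGL x * k * (upperGL x)⁻¹ := by rw [← hk]; group
    rw [this, mem_splitCartan_iff, Units.val_mul, Units.val_mul, upperGL_inv_coe, upperGL_coe,
      Matrix.eta_fin_two k.val, hk10]
    simp
    linear_combination -hxv

section

variable {H : Subgroup (GL (Fin 2) (ZMod (p ^ 2)))} {w z : (ZMod (p ^ 2))ˣ}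

lemma red_inv_unit (w : (ZMod (p ^ 2))ˣ) :
    red p ((w⁻¹ : (ZMod (p ^ 2))ˣ) : ZMod (p ^ 2)) = (red p w)⁻¹ := by
  apply eq_inv_of_mul_eq_one_left
  rw [← map_mul, Units.inv_mul, map_one]

lemma conj_diagGL_entries {S : Type*} [CommRing S] (w z : Sˣ) (g : GL (Fin 2) S) :
    (diagGL w z * g * (diagGL w z)⁻¹).val =
      !![g 0 0, (w : S) * ((z⁻¹ : Sˣ) : S) * g 0 1;
        (z : S) * ((w⁻¹ : Sˣ) : S) * g 1 0, g 1 1] := by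
  rw [Units.val_mul, Units.val_mul, diagGL_coe, diagGL_inv_coe, Matrix.eta_fin_two g.val]
  ext i j
  fin_cases i <;> fin_cases j <;> simp
  · rw [mul_right_comm, Units.mul_inv, one_mul]
  · ring
  · ring
  · rw [mul_right_comm, Units.mul_inv, one_mul]

/-- The grading by the weights of a diagonal element with distinct eigenvalues modulo `p`. -/
lemma graded_of_diagGL_mem (hp3 : 3 < p) (hup : ∀ g ∈ H, reduction p g 1 0 = 0)
    (hu : unipotent (ZMod p) ∈ H.map (reduction p)) (hwz : red p w ≠ red p z)
    (hh : diagGL w z ∈ H) : Graded H := by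
  have hw := red_ne_zero_of_isUnit w.isUnit
  have hz := red_ne_zero_of_isUnit z.isUnit
  have hne : red p z * (red p w)⁻¹ - 1 ≠ 0 := by
    rw [sub_ne_zero]
    intro h0
    apply hwz
    field_simp at h0
    exact h0.symm
  have he := e_mem_kerModule hp3 hu
  have hf : ∀ B ∈ kerModule H, B 1 0 ≠ 0 → !![0, 0; 1, 0] ∈ kerModule H := by
    intro B hB hB0
    have h1 : !![B 0 0, red p w * (red p z)⁻¹ * B 0 1; red p z * (red p w)⁻¹ * B 1 0, B 1 1] ∈
        kerModule H := by
      have := H.mul_mem (H.mul_mem hh hB) (H.inv_mem hh)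
      rw [mem_kerModule]
      convert this
      apply Units.ext
      rw [conj_diagGL_entries]
      ext i j
      fin_cases i <;> fin_cases j <;> simp [kerElt_apply, mul_mulP, mul_assoc]
    have h2 := (kerModule H).smul_mem ((red p z * (red p w)⁻¹ - 1) * B 1 0)⁻¹
      ((kerModule H).sub_mem h1 hB)
    refine mem_kerModule_of_e he (y := ((red p z * (red p w)⁻¹ - 1) * B 1 0)⁻¹ *
      (red p w * (red p z)⁻¹ * B 0 1 - B 0 1)) ?_ 0
    convert h2 using 1
    ext i j
    fin_cases i <;> fin_cases j <;> simp
    field_simp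
  refine ⟨hup, fun g hg h01 => ?_, hf⟩
  have h10 := hup g hg
  have hg0 := (diag_ne_zero_of_lower_eq_zero h10)
  obtain ⟨b, hb⟩ := exists_mulP_of_red_eq (x := g 0 1) (y := 0) (by rw [map_zero]; exact h01)
  obtain ⟨c, hc⟩ := exists_mulP_of_red_eq (x := g 1 0) (y := 0) (by rw [map_zero]; exact h10)
  rw [zero_add] at hb hc
  have hcf : c • !![0, 0; 1, 0] ∈ kerModule H := by
    by_cases hc0 : c = 0
    · rw [hc0, zero_smul]; exact (kerModule H).zero_mem
    refine (kerModule H).smul_mem c ?_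
    have hX := H.mul_mem (H.mul_mem hh hg) (H.inv_mem hh)
    have hred : reduction p (diagGL w z * g * (diagGL w z)⁻¹) = reduction p g := by
      ext i j
      rw [reduction_apply, conj_diagGL_entries, reduction_apply]
      fin_cases i <;> fin_cases j <;> simp [hb, hc]
    obtain ⟨B, hB⟩ := exists_eq_mul_kerElt hred
    have hBH : B ∈ kerModule H := by
      rw [hB] at hX
      exact (H.mul_mem_cancel_left hg).1 hX
    refine hf B hBH fun hB0 => hc0 ?_
    have h1 : (diagGL w z * g * (diagGL w z)⁻¹) 1 0 = (g * kerElt B) 1 0 := by rw [hB]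
    rw [conj_diagGL_entries, mul_kerElt_apply, Matrix.mul_apply, Fin.sum_univ_two, h10, hB0,
      zero_mul, mul_zero, add_zero, map_zero, add_zero] at h1
    simp only [Matrix.of_apply, Matrix.cons_val', Matrix.cons_val_one, Matrix.cons_val_zero,
      Matrix.cons_val_fin_one, hc, mul_mulP, map_mul, red_inv_unit] at h1
    have h2 := mulP_injective h1
    exact (mul_eq_zero.1 (by linear_combination h2 :
      (red p z * (red p w)⁻¹ - 1) * c = 0)).resolve_left hne
  set X : Matrix (Fin 2) (Fin 2) (ZMod p) := (-(b / reduction p g 0 0)) • !![0, 1; 0, 0] +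
    (-(1 / reduction p g 1 1)) • (c • !![0, 0; 1, 0]) with hX
  have hXH : X ∈ kerModule H :=
    (kerModule H).add_mem ((kerModule H).smul_mem _ he) ((kerModule H).smul_mem _ hcf)
  refine ⟨g * kerElt X, H.mul_mem hg hXH, ?_, ?_⟩
  · rw [mem_splitCartan_iff, mul_kerElt_apply, mul_kerElt_apply, Matrix.mul_apply,
      Matrix.mul_apply, Fin.sum_univ_two, Fin.sum_univ_two, hb, hc, h10, h01]
    simp [hX, mul_div_cancel₀ _ hg0.1, hg0.2]
  · rw [map_mul, reduction_kerElt, mul_one]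

/-- In the presence of a diagonal element with distinct eigenvalues modulo `p`, the lift of the
unipotent matrix can be made an eigenvector of that element. Its lower left entry survives only if
the ratio of the eigenvalues is `-1`. -/
lemma exists_normalized_lift (hp3 : 3 < p) (hG : Graded H) (hwz : red p w ≠ red p z)
    (hh : diagGL w z ∈ H) {τ : GL (Fin 2) (ZMod (p ^ 2))} (hτ : τ ∈ H) {a b c d : ZMod p}
    (hτe : τ.val = !![1 + mulP p a, 1 + mulP p b; mulP p c, 1 + mulP p d])
    (hc : c = 0 ∨ !![0, 0; 1, 0] ∉ kerModule H) : ∃ σ ∈ H,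
      σ.val = !![1 + mulP p (c / 2), 1; mulP p c, 1 + mulP p (c / 2)] := by
  have hw := red_ne_zero_of_isUnit w.isUnit
  have hz := red_ne_zero_of_isUnit z.isUnit
  have h2 := two_ne_zero_of_three_lt hp3
  have hτr := reduction_eq_unipotent hτe
  have he := e_mem_kerModule hp3 ⟨τ, hτ, hτr⟩
  set χ := red p w * (red p z)⁻¹ with hχ
  have hχ0 : χ ≠ 0 := mul_ne_zero hw (inv_ne_zero hz)
  have hχ1 : 1 - χ ≠ 0 := by
    rw [sub_ne_zero]
    intro h0
    apply hwz
    rw [hχ] at h0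
    field_simp at h0
    exact h0.symm
  have hχi : red p z * (red p w)⁻¹ = χ⁻¹ := by rw [hχ, mul_inv, inv_inv, mul_comm]
  have hn : ((χ.val : ℕ) : ZMod p) = χ := ZMod.natCast_zmod_val χ
  have hpow := pow_entries hτe χ.val
  have hch := two_mul_cast_choose_two (S := ZMod p) χ.val
  rw [hn] at hpow hch
  set C := ((χ.val.choose 2 : ℕ) : ZMod p)
  have hconj := conj_diagGL_entries w z τ
  have hred : reduction p (diagGL w z * τ * (diagGL w z)⁻¹) = reduction p (τ ^ χ.val) := by
    rw [map_pow, hτr, unipotent_pow, hn]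
    ext i j
    rw [reduction_apply, hconj, hτe]
    fin_cases i <;> fin_cases j <;> simp [upperGL_coe, hχ]
  obtain ⟨B, hB⟩ := exists_eq_mul_kerElt hred
  have hBH : B ∈ kerModule H := by
    have hX := H.mul_mem (H.mul_mem hh hτ) (H.inv_mem hh)
    rw [hB] at hX
    exact (H.mul_mem_cancel_left (H.pow_mem hτ _)).1 hX
  have hent : ∀ i j, (diagGL w z * τ * (diagGL w z)⁻¹) i j = (τ ^ χ.val * kerElt B) i j :=
    fun i j => by rw [hB]
  have hredpow : (reduction p (τ ^ χ.val)).val = !![1, χ; 0, 1] := by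
    rw [map_pow, hτr, unipotent_pow, hn, upperGL_coe]
  simp only [hconj, hτe, mul_kerElt_apply, hpow, hredpow] at hent
  have h10 : χ⁻¹ * c = χ * c + B 1 0 := by
    have := hent 1 0
    simp only [Matrix.mul_apply, Fin.sum_univ_two] at this
    simp [mul_mulP, hχi] at this
    rw [← map_add] at this
    have := mulP_injective this
    rw [← this, ← hχi]
  have h00 : a = χ * a + C * c + (B 0 0 + χ * B 1 0) := by
    have := hent 0 0
    simp only [Matrix.mul_apply, Fin.sum_univ_two] at this
    simp [add_assoc] at this
    simp only [← map_add] at this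
    have := mulP_injective this
    linear_combination this
  have h11 : d = χ * d + C * c + B 1 1 := by
    have := hent 1 1
    simp only [Matrix.mul_apply, Fin.sum_univ_two] at this
    simp [add_assoc] at this
    simp only [← map_add] at this
    have := mulP_injective this
    linear_combination this
  have hB10 : B 1 0 = 0 := by
    by_contra h0
    rcases hc with hc | hc
    · rw [hc] at h10
      simp at h10
      exact h0 h10.symm
    · exact hc (hG.f_mem B hBH h0)
  have hcχ : (1 + χ) * c = 0 := by
    rw [hB10, add_zero] at h10
    field_simp at h10
    have : (1 - χ) * ((1 + χ) * c) = 0 := by linear_combination h10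
    exact (mul_eq_zero.1 this).resolve_left hχ1
  -- Both diagonal entries of `B` determine those of `τ`, up to the contribution of `c`.
  have hdiag : !![a - c / 2, 0; 0, d - c / 2] ∈ kerModule H := by
    convert (kerModule H).smul_mem (1 - χ)⁻¹ (hG.diag_mem he hBH) using 1
    rw [hB10] at h00
    ext i j
    fin_cases i <;> fin_cases j <;> simp
    · field_simp
      linear_combination 2 * h00 + c * hch - hcχ + χ * hcχ
    · field_simp
      linear_combination 2 * h11 + c * hch - hcχ + χ * hcχ
  have hX := (kerModule H).neg_mem (mem_kerModule_of_e he hdiag (b - (d - c / 2)))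
  refine ⟨_, H.mul_mem hτ hX, ?_⟩
  ext i j
  rw [mul_kerElt_apply, hτr, unipotent_coe, hτe, Matrix.mul_apply, Fin.sum_univ_two]
  fin_cases i <;> fin_cases j <;> simp
  all_goals ring

end

lemma diagGL_mul_comm {S : Type*} [CommRing S] (w z w' z' : Sˣ) :
    diagGL w z * diagGL w' z' = diagGL w' z' * diagGL w z := by
  ext i j
  fin_cases i <;> fin_cases j <;> simp [diagGL_coe, mul_comm]

lemma upperGL_conj_unipotent {S : Type*} [CommRing S] (s : S) :
    upperGL s * unipotent S * (upperGL s)⁻¹ = unipotent S := by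
  rw [mul_inv_eq_iff_eq_mul, ← upperGL_one, upperGL_mul, upperGL_mul, add_comm]

lemma reduction_diagGL_apply_one_zero (w z : (ZMod (p ^ 2))ˣ) :
    reduction p (diagGL w z) 1 0 = 0 := by
  rw [reduction_apply, diagGL_coe]; simp

lemma reduction_diagGL_coe (w z : (ZMod (p ^ 2))ˣ) :
    (reduction p (diagGL w z)).val = !![red p w, 0; 0, red p z] := by
  ext i j
  rw [reduction_apply, diagGL_coe]
  fin_cases i <;> fin_cases j <;> simp

lemma red_ne_of_isConj {g g' : GL (Fin 2) (ZMod (p ^ 2))} (hc : IsConj g g')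
    (h0 : reduction p g 1 0 = 0) (h0' : reduction p g' 1 0 = 0)
    (hne : red p (g 0 0) ≠ red p (g 1 1)) : red p (g' 0 0) ≠ red p (g' 1 1) := by
  have htr := trace_eq_of_isConj ((reduction p).map_isConj hc)
  have hde := det_eq_of_isConj ((reduction p).map_isConj hc)
  rw [h0, h0', mul_zero, mul_zero, sub_zero, sub_zero] at hde
  simp only [reduction_apply] at htr hde
  intro h
  apply hne
  rw [← sub_eq_zero, ← sq_eq_zero_iff]
  linear_combination (red p (g 0 0) + red p (g 1 1) + red p (g' 0 0) + red p (g' 1 1)) * htr -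
    4 * hde + (red p (g' 0 0) - red p (g' 1 1)) * h

section

variable {H H₁ H₂ : Subgroup (GL (Fin 2) (ZMod (p ^ 2)))}

lemma exists_conj_graded (hp3 : 3 < p) {ε : ZMod p} (hε : ¬ IsSquare ε)
    (hup : ∀ g ∈ H, reduction p g 1 0 = 0) (hu : unipotent (ZMod p) ∈ H.map (reduction p))
    (hreg : ∃ h ∈ H, red p (h 0 0) ≠ red p (h 1 1)) :
    ∃ K, ConjugateSubgroups H K ∧ Graded K ∧ ∃ c : ZMod p, (c = 0 ∨ c = 1 ∨ c = ε) ∧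
      (c = 0 ∨ !![0, 0; 1, 0] ∉ kerModule K) ∧ ∃ σ ∈ K,
        σ.val = !![1 + mulP p (c / 2), 1; mulP p c, 1 + mulP p (c / 2)] := by
  obtain ⟨h, hh, hne⟩ := hreg
  obtain ⟨τ₀, hτ₀, hτ₀r⟩ := hu
  obtain ⟨g, s, hg, w, z, hwz⟩ := exists_conj_mem_splitCartan (hup h hh) hne
  have hg0 : reduction p g 1 0 = 0 := by rw [hg, upperGL_coe]; simp
  have hd : diagGL w z ∈ H.map (MulAut.conj g).toMonoidHom := by
    rw [← hwz]; exact conj_mem_map_conj hh g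
  have hne' : red p w ≠ red p z := by
    have := red_ne_of_isConj (isConj_iff.2 ⟨g, hwz⟩) (hup h hh)
      (reduction_diagGL_apply_one_zero w z) hne
    simpa [diagGL_coe] using this
  have hτ₁ := conj_mem_map_conj hτ₀ g
  have hτ₁r : reduction p (g * τ₀ * g⁻¹) = unipotent (ZMod p) := by
    rw [map_mul, map_mul, map_inv, hτ₀r, hg, upperGL_conj_unipotent]
  obtain ⟨a, b, c, d, hτe⟩ := exists_entries hτ₁r
  obtain ⟨m, hm, hmc⟩ := exists_sq_mul_eq hε c
  obtain ⟨n, μ, b', t, hent⟩ := exists_scaled_entries hτe hm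
  set K := (H.map (MulAut.conj g).toMonoidHom).map (MulAut.conj (diagGL μ 1)).toMonoidHom with hK
  have hupK : ∀ x ∈ K, reduction p x 1 0 = 0 :=
    upper_map_conj (upper_map_conj hup hg0) (reduction_diagGL_apply_one_zero μ 1)
  have hdK : diagGL w z ∈ K := by
    rw [hK, mem_map_conj, mul_assoc, diagGL_mul_comm, inv_mul_cancel_left]
    exact hd
  have hτK : diagGL μ 1 * (g * τ₀ * g⁻¹) ^ n * (diagGL μ 1)⁻¹ ∈ K :=
    conj_mem_map_conj (Subgroup.pow_mem _ hτ₁ n) _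
  have huK : unipotent (ZMod p) ∈ K.map (reduction p) := ⟨_, hτK, reduction_eq_unipotent hent⟩
  have hG := graded_of_diagGL_mem hp3 hupK huK hne' hdK
  refine ⟨K, (conjugateSubgroups_map H g).trans (conjugateSubgroups_map _ _), hG, ?_⟩
  by_cases hf : !![0, 0; 1, 0] ∈ kerModule K
  · refine ⟨0, Or.inl rfl, Or.inl rfl, ?_⟩
    have hX := (kerModule K).smul_mem (-(m ^ 2 * c)) hf
    refine exists_normalized_lift hp3 hG hne' hdK (K.mul_mem hτK hX)
      (a := m * a + t * c - m ^ 2 * c) (b := b') (d := m * d + t * c) ?_ (Or.inl rfl)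
    ext i j
    rw [mul_kerElt_apply, reduction_eq_unipotent hent, unipotent_coe, hent, Matrix.mul_apply,
      Fin.sum_univ_two]
    fin_cases i <;> fin_cases j <;> simp
    ring
  · exact ⟨_, hmc, Or.inr hf, exists_normalized_lift hp3 hG hne' hdK hτK hent (Or.inr hf)⟩

lemma isListedLift_of_entries {ε a c : ZMod p} {σ : GL (Fin 2) (ZMod (p ^ 2))}
    (hσ : σ.val = !![1 + mulP p a, 1; mulP p c, 1 + mulP p a])
    (h : (c = 0 ∧ (a = 0 ∨ a = 1)) ∨ c = 1 ∨ c = ε) : IsListedLift ε σ := by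
  have key : σ.val = !![1, 1; 0, 1] + timesP !![a, 0; c, a] := by
    rw [hσ, timesP_eq]
    ext i j
    fin_cases i <;> fin_cases j <;> simp
  rcases h with ⟨rfl, rfl | rfl⟩ | rfl | rfl
  · left
    rw [hσ]; simp
  · exact Or.inr (Or.inl key)
  · exact Or.inr (Or.inr (Or.inl ⟨a, key⟩))
  · exact Or.inr (Or.inr (Or.inr ⟨a, key⟩))

lemma listedPair_of_distinct_eigenvalues (hp3 : 3 < p) {ε : ZMod p} (hε : ¬ IsSquare ε)
    (hH : SameClasses H₁ H₂) (hnc : ¬ ConjugateSubgroups H₁ H₂)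
    (hup₁ : ∀ g ∈ H₁, reduction p g 1 0 = 0) (hup₂ : ∀ g ∈ H₂, reduction p g 1 0 = 0)
    (hu₁ : unipotent (ZMod p) ∈ H₁.map (reduction p))
    (hu₂ : unipotent (ZMod p) ∈ H₂.map (reduction p))
    (hreg : ∃ h ∈ H₁, red p (h 0 0) ≠ red p (h 1 1)) : ListedPair ε H₁ H₂ := by
  have hreg₂ : ∃ h ∈ H₂, red p (h 0 0) ≠ red p (h 1 1) := by
    obtain ⟨h, hh, hne⟩ := hreg
    obtain ⟨h', hh', hc⟩ := hH.1 h hh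
    exact ⟨h', hh', red_ne_of_isConj hc (hup₁ h hh) (hup₂ h' hh') hne⟩
  obtain ⟨K₁, hK₁, hG₁, c₁, hc₁, hcf₁, σ₁, hσ₁, he₁⟩ := exists_conj_graded hp3 hε hup₁ hu₁ hreg
  obtain ⟨K₂, hK₂, hG₂, c₂, hc₂, hcf₂, σ₂, hσ₂, he₂⟩ := exists_conj_graded hp3 hε hup₂ hu₂ hreg₂
  have hK := hH.of_conj hK₁ hK₂
  have he₁' : σ₁.val = !![1 + mulP p (c₁ / 2), 1 + mulP p 0; mulP p c₁, 1 + mulP p (c₁ / 2)] := by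
    rw [he₁, map_zero, add_zero]
  have he₂' : σ₂.val = !![1 + mulP p (c₂ / 2), 1 + mulP p 0; mulP p c₂, 1 + mulP p (c₂ / 2)] := by
    rw [he₂, map_zero, add_zero]
  have hr₁ := reduction_eq_unipotent he₁'
  have hr₂ := reduction_eq_unipotent he₂'
  have hc : c₁ = c₂ := by
    by_cases hf : !![0, 0; 1, 0] ∈ kerModule K₂
    · have hf₁ := f_mem_of_sameClasses hp3 hε hG₁ ⟨σ₂, hσ₂, hr₂⟩ hK.symm hf
      rw [hcf₁.resolve_right (not_not.2 hf₁), hcf₂.resolve_right (not_not.2 hf)]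
    · -- Compare the lower left entries of `σ₁` and of a conjugate in `K₂`.
      obtain ⟨g, hg, hgc⟩ := hK.1 σ₁ hσ₁
      have hgc' := (reduction p).map_isConj hgc
      rw [hr₁, ← upperGL_one] at hgc'
      obtain ⟨m, hm, hgm⟩ := exists_eq_upperGL_of_isConj one_ne_zero (hG₂.upper g hg) hgc'
      have hmv : ((m.val : ℕ) : ZMod p) = m := ZMod.natCast_zmod_val m
      have hred : reduction p (σ₂ ^ m.val) = upperGL m := by
        rw [map_pow, hr₂, unipotent_pow, hmv]
      obtain ⟨B, hB⟩ := exists_eq_mul_kerElt (hgm.trans hred.symm)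
      have hBK : B ∈ kerModule K₂ := by
        rw [hB] at hg
        exact (K₂.mul_mem_cancel_left (K₂.pow_mem hσ₂ _)).1 hg
      have hB10 : B 1 0 = 0 := by
        by_contra h0
        exact hf (hG₂.f_mem B hBK h0)
      have hg10 : g 1 0 = mulP p (m * c₂) := by
        rw [hB, mul_kerElt_apply, hred, upperGL_coe, pow_entries he₂', hmv, Matrix.mul_apply,
          Fin.sum_univ_two, hB10]
        simp
      have hgd : red p (g 0 0) = red p (g 1 1) := by
        rw [← reduction_apply, ← reduction_apply, hgm, upperGL_coe]; simp
      have hg01 : red p (g 0 1) = m := by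
        rw [← reduction_apply, hgm, upperGL_coe]; simp
      have hl := lower_entry_of_isConj hp3 hgc (x := c₁) (by rw [he₁]; simp) hg10
        (by rw [he₁]; simp) hgd
      rw [hg01, he₁] at hl
      simp at hl
      exact eq_of_sq_mul_eq hε hm hc₁ hc₂ (by rw [hl]; ring)
  subst hc
  have hσ : σ₁ = σ₂ := Units.ext (he₁.trans he₂.symm)
  subst hσ
  refine (hG₁.listedPair hp3 hε hG₂ hK ?_ (τ := σ₁) ?_ hσ₁ hσ₂).of_conj hK₁ hK₂
  · rintro rfl
    exact hnc (hK₁.trans hK₂.symm)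
  · refine isListedLift_of_entries he₁ (hc₁.imp ?_ id)
    rintro rfl
    simp

/-! ### Subgroups whose elements have equal eigenvalues modulo `p` -/

/-- The reduction of every element of `H` is upper triangular with equal diagonal entries. -/
def EqualEigenvalues (H : Subgroup (GL (Fin 2) (ZMod (p ^ 2)))) : Prop :=
  ∀ g ∈ H, reduction p g 1 0 = 0 ∧ red p (g 0 0) = red p (g 1 1)

lemma EqualEigenvalues.map_conj (hH : EqualEigenvalues H) {g : GL (Fin 2) (ZMod (p ^ 2))}
    (hg : reduction p g 1 0 = 0) : EqualEigenvalues (H.map (MulAut.conj g).toMonoidHom) := by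
  intro x hx
  have h0 := upper_map_conj (fun y hy => (hH y hy).1) hg x hx
  refine ⟨h0, ?_⟩
  by_contra hne
  obtain ⟨y, hy, rfl⟩ := hx
  exact red_ne_of_isConj (IsConj.symm (isConj_iff.2 ⟨g, rfl⟩)) h0 (hH y hy).1 hne (hH y hy).2

/-- Conjugation by an element of the kernel of reduction makes a lift of the unipotent matrix agree
with it in the upper right entry and makes its diagonal entries equal. -/
lemma exists_kerElt_conj_entries (hp3 : 3 < p) {τ : GL (Fin 2) (ZMod (p ^ 2))} {a b c d : ZMod p}
    (h : τ.val = !![1 + mulP p a, 1 + mulP p b; mulP p c, 1 + mulP p d]) :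
    ∃ X : Matrix (Fin 2) (Fin 2) (ZMod p), (kerElt X * τ * (kerElt X)⁻¹).val =
      !![1 + mulP p ((a + d) / 2), 1; mulP p c, 1 + mulP p ((a + d) / 2)] := by
  have h2 := two_ne_zero_of_three_lt hp3
  have hτr := reduction_eq_unipotent h
  refine ⟨!![-b, 0; (a - d) / 2, 0], ?_⟩
  ext i j
  rw [← kerElt_neg, mul_kerElt_apply, map_mul, reduction_kerElt, one_mul, hτr, unipotent_coe,
    Units.val_mul, kerElt_coe, h, Matrix.mul_apply, Matrix.mul_apply, Fin.sum_univ_two,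
    Fin.sum_univ_two]
  fin_cases i <;> fin_cases j <;> simp [mul_add, add_mul, mul_mulP, add_assoc]
  · simp only [← map_neg, ← map_add]
    congr 1
    field_simp
    ring
  · rw [add_left_comm, ← map_add]
    congr 2
    field_simp
    ring

/-- Every lift of the unipotent matrix has a power that is conjugate to a listed lift. -/
lemma exists_conj_pow_isListedLift (hp3 : 3 < p) {ε : ZMod p} (hε : ¬ IsSquare ε)
    {τ : GL (Fin 2) (ZMod (p ^ 2))} (h : reduction p τ = unipotent (ZMod p)) :
    ∃ (n : ℕ) (g : GL (Fin 2) (ZMod (p ^ 2))), reduction p g 1 0 = 0 ∧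
      IsListedLift ε (g * τ ^ n * g⁻¹) := by
  have h2 := two_ne_zero_of_three_lt hp3
  obtain ⟨a, b, c, d, he⟩ := exists_entries h
  obtain ⟨m, hm, hmc⟩ : ∃ m : ZMod p, m ≠ 0 ∧
      ((c = 0 ∧ (m * (a + d) / 2 = 0 ∨ m * (a + d) / 2 = 1)) ∨ m ^ 2 * c = 1 ∨ m ^ 2 * c = ε) := by
    by_cases hc : c = 0
    · by_cases had : a + d = 0
      · exact ⟨1, one_ne_zero, Or.inl ⟨hc, Or.inl (by rw [had]; simp)⟩⟩
      · exact ⟨2 / (a + d), div_ne_zero h2 had, Or.inl ⟨hc, Or.inr (by field_simp)⟩⟩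
    · obtain ⟨m, hm, hmc⟩ := exists_sq_mul_eq hε c
      exact ⟨m, hm, Or.inr (hmc.resolve_left (mul_ne_zero (pow_ne_zero 2 hm) hc))⟩
  obtain ⟨n, μ, b', t, hent⟩ := exists_scaled_entries he hm
  obtain ⟨X, hX⟩ := exists_kerElt_conj_entries hp3 hent
  refine ⟨n, kerElt X * diagGL μ 1, ?_, ?_⟩
  · rw [map_mul, reduction_kerElt, one_mul, reduction_diagGL_apply_one_zero]
  · have : kerElt X * diagGL μ 1 * τ ^ n * (kerElt X * diagGL μ 1)⁻¹ =
        kerElt X * (diagGL μ 1 * τ ^ n * (diagGL μ 1)⁻¹) * (kerElt X)⁻¹ := by group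
    rw [this]
    refine isListedLift_of_entries hX (hmc.imp_left ?_)
    rintro ⟨rfl, h0⟩
    refine ⟨mul_zero _, ?_⟩
    convert h0 using 2 <;> ring

/-- An element that is scalar modulo `p` has the same `p`-th power as any scalar lift of its
reduction. -/
lemma pow_p_eq {g : GL (Fin 2) (ZMod (p ^ 2))} {v : (ZMod (p ^ 2))ˣ}
    (h : reduction p g = reduction p (diagGL v v)) : g ^ p = diagGL v v ^ p := by
  obtain ⟨B, rfl⟩ := exists_eq_mul_kerElt h
  have hcomm : Commute (diagGL v v) (kerElt B) := by
    ext i j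
    rw [Units.val_mul, Units.val_mul, diagGL_coe, Matrix.eta_fin_two (kerElt B).val]
    fin_cases i <;> fin_cases j <;> simp [mul_comm]
  have hB : kerElt B ^ p = 1 := by
    have hn : ∀ n : ℕ, kerElt B ^ n = kerElt (n • B) := by
      intro n
      induction n with
      | zero => simp [kerElt_zero]
      | succ n ih => rw [pow_succ (kerElt B) n, ih, succ_nsmul, kerElt_add]
    rw [hn, ← Nat.cast_smul_eq_nsmul (ZMod p), CharP.cast_eq_zero, zero_smul, kerElt_zero]
  rw [hcomm.mul_pow, hB, mul_one]

lemma diagGL_pow {S : Type*} [CommRing S] (w z : Sˣ) (n : ℕ) :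
    diagGL w z ^ n = diagGL (w ^ n) (z ^ n) := by
  induction n with
  | zero => ext i j; fin_cases i <;> fin_cases j <;> simp [diagGL_coe]
  | succ n ih =>
    rw [pow_succ (diagGL w z) n, ih]
    ext i j
    fin_cases i <;> fin_cases j <;> simp [diagGL_coe, pow_succ]

lemma reduction_pow_p (v : (ZMod (p ^ 2))ˣ) :
    reduction p (diagGL v v ^ p) = reduction p (diagGL v v) := by
  rw [diagGL_pow]
  ext i j
  rw [reduction_apply, reduction_apply]
  fin_cases i <;> fin_cases j <;> simp [diagGL_coe]

lemma EqualEigenvalues.exists_scalar (hH : EqualEigenvalues H) {g : GL (Fin 2) (ZMod (p ^ 2))}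
    (hg : g ∈ H) (h01 : reduction p g 0 1 = 0) :
    ∃ v : (ZMod (p ^ 2))ˣ, reduction p g = reduction p (diagGL v v) := by
  obtain ⟨h10, hd⟩ := hH g hg
  obtain ⟨v, hv⟩ := isUnit_of_red_ne_zero (diag_ne_zero_of_lower_eq_zero h10).1
  refine ⟨v, ?_⟩
  ext i j
  rw [reduction_apply] at h10 h01
  rw [reduction_apply, reduction_apply, diagGL_coe, hv]
  fin_cases i <;> fin_cases j <;> simp [h10, h01, hd]

lemma EqualEigenvalues.graded (hH : EqualEigenvalues H)
    (hf : ∀ B ∈ kerModule H, B 1 0 ≠ 0 → !![0, 0; 1, 0] ∈ kerModule H) : Graded H := by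
  refine ⟨fun g hg => (hH g hg).1, fun g hg h01 => ?_, hf⟩
  obtain ⟨v, hv⟩ := hH.exists_scalar hg h01
  refine ⟨g ^ p, H.pow_mem hg p, ?_, ?_⟩
  · rw [pow_p_eq hv, diagGL_pow]
    exact ⟨_, _, rfl⟩
  · rw [pow_p_eq hv, reduction_pow_p, hv]

end

/-! ### Affine maps preserving squares -/

/-- The set of `w` with `1 - b w` a square determines `b`: two such sets being equal with
`b₁ ≠ b₂`, an affine map would preserve the squares, and its commutator with multiplication by `4`
would be a translation preserving the squares. -/
lemma eq_of_isSquare_one_sub_iff (hp3 : 3 < p) {ε : ZMod p} (hε : ¬ IsSquare ε) {b₁ b₂ : ZMod p}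
    (h : ∀ w : ZMod p, IsSquare (1 - b₁ * w) ↔ IsSquare (1 - b₂ * w)) : b₁ = b₂ := by
  have h2 := two_ne_zero_of_three_lt hp3
  by_contra hne
  by_cases hb₁ : b₁ = 0
  · have hb₂ : b₂ ≠ 0 := fun h0 => hne (hb₁.trans h0.symm)
    have := (h ((1 - ε) / b₂)).1 (by rw [hb₁]; simp)
    rw [mul_div_cancel₀ _ hb₂, sub_sub_cancel] at this
    exact hε this
  by_cases hb₂ : b₂ = 0
  · have := (h ((1 - ε) / b₁)).2 (by rw [hb₂]; simp)
    rw [mul_div_cancel₀ _ hb₁, sub_sub_cancel] at this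
    exact hε this
  have h12 : ∀ x : ZMod p, IsSquare x ↔ IsSquare (1 - b₂ / b₁ * (1 - x)) := by
    intro x
    have := h ((1 - x) / b₁)
    rw [mul_div_cancel₀ _ hb₁, sub_sub_cancel] at this
    rw [this]
    congr! 1
    ring
  have h4 : ∀ x : ZMod p, IsSquare x ↔ IsSquare (4 * x) := by
    intro x
    constructor
    · rintro ⟨s, rfl⟩
      exact ⟨2 * s, by ring⟩
    · rintro ⟨s, hs⟩
      refine ⟨s / 2, ?_⟩
      field_simp
      linear_combination hs
  have ht : (1 - b₂ / b₁) * (-3) ≠ 0 := by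
    refine mul_ne_zero ?_ (neg_ne_zero.2 (three_ne_zero_of_three_lt hp3))
    rw [sub_ne_zero, Ne, eq_div_iff hb₁, one_mul]
    exact hne
  refine hε (isSquare_of_forall_isSquare_add ht (fun x hx => ?_) ε)
  have h1 : IsSquare (1 - b₁ / b₂ * (1 - x / 4)) := by
    rw [h12]
    have : IsSquare (x / 4) := by
      rw [h4]
      have : (4 : ZMod p) ≠ 0 := by
        rw [show (4 : ZMod p) = 2 * 2 by norm_num]; exact mul_ne_zero h2 h2
      rwa [mul_div_cancel₀ _ this]
    convert this using 1
    field_simp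
    ring
  rw [h4, h12] at h1
  convert h1 using 1
  have : (4 : ZMod p) ≠ 0 := by
    rw [show (4 : ZMod p) = 2 * 2 by norm_num]; exact mul_ne_zero h2 h2
  field_simp
  ring

/-! ### Subgroups with equal eigenvalues that are not graded -/

/-- A normal form for the subgroups whose elements have equal eigenvalues modulo `p` and that are
not graded: `1 + (1 + E₂₁) p` is in `H`, while `1 + E₂₁ p` is not. -/
structure NongradedForm (b : ZMod p) (H : Subgroup (GL (Fin 2) (ZMod (p ^ 2)))) : Prop where
  equalEigenvalues : EqualEigenvalues H
  mem : !![1, 0; 1, 1] ∈ kerModule H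
  not_mem : !![0, 0; 1, 0] ∉ kerModule H
  lift : ∃ V ∈ H, V.val = !![1 + mulP p b, 1; 0, 1 + mulP p b]

section

variable {H H₁ H₂ : Subgroup (GL (Fin 2) (ZMod (p ^ 2)))}

lemma exists_conj_nongradedForm (hp3 : 3 < p) (hE : EqualEigenvalues H)
    (hu : unipotent (ZMod p) ∈ H.map (reduction p)) (hf : !![0, 0; 1, 0] ∉ kerModule H)
    {B : Matrix (Fin 2) (Fin 2) (ZMod p)} (hB : B ∈ kerModule H) (hB0 : B 1 0 ≠ 0) :
    ∃ (K : Subgroup (GL (Fin 2) (ZMod (p ^ 2)))) (b : ZMod p), ConjugateSubgroups H K ∧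
      NongradedForm b K := by
  have h2 := two_ne_zero_of_three_lt hp3
  have he := e_mem_kerModule hp3 hu
  have hh := h_mem_kerModule hp3 hu hB hB0
  set α := (B 0 0 + B 1 1) / (2 * B 1 0) with hα
  have hfα : !![α, 0; 1, α] ∈ kerModule H := by
    refine mem_kerModule_of_e he (y := (B 1 0)⁻¹ * B 0 1) ?_ 0
    convert (kerModule H).sub_mem ((kerModule H).smul_mem (B 1 0)⁻¹ hB)
      ((kerModule H).smul_mem ((B 0 0 - B 1 1) / (2 * B 1 0)) hh) using 1
    ext i j
    fin_cases i <;> fin_cases j <;> simp [hα, hB0]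
    all_goals field_simp; ring
  have hα0 : α ≠ 0 := by
    intro h0
    rw [h0] at hfα
    exact hf hfα
  -- Conjugation by a diagonal matrix replaces `α` by `1`.
  obtain ⟨x, hx⟩ := red_surjective α⁻¹
  obtain ⟨μ, rfl⟩ := isUnit_of_red_ne_zero (x := x) (by rw [hx]; exact inv_ne_zero hα0)
  set K := H.map (MulAut.conj (diagGL μ 1)).toMonoidHom with hK
  have hKE : EqualEigenvalues K := hE.map_conj (reduction_diagGL_apply_one_zero μ 1)
  have hconj : ∀ y z : ZMod p,
      diagGL μ 1 * kerElt !![y, 0; z, y] * (diagGL μ 1)⁻¹ = kerElt !![y, 0; α * z, y] := by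
    intro y z
    apply Units.ext
    rw [conj_diagGL_entries]
    ext i j
    fin_cases i <;> fin_cases j <;> simp [kerElt_apply, mul_mulP, hx]
  have hKmem : !![1, 0; 1, 1] ∈ kerModule K := by
    have h1 : kerElt !![α, 0; α * 1, α] ∈ K := by
      rw [← hconj]
      exact conj_mem_map_conj hfα _
    convert (kerModule K).smul_mem α⁻¹ (mem_kerModule.2 h1) using 1
    ext i j
    fin_cases i <;> fin_cases j <;> simp [hα0]
  have hKf : !![0, 0; 1, 0] ∉ kerModule K := by
    intro h0
    apply hf
    have h1 := (kerModule K).smul_mem α h0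
    have h3 : diagGL μ 1 * kerElt !![0, 0; 1, 0] * (diagGL μ 1)⁻¹ ∈ K := by
      rw [hconj]
      rw [mem_kerModule] at h1
      convert h1 using 2
      ext i j
      fin_cases i <;> fin_cases j <;> simp
    rw [hK, mem_map_conj] at h3
    rw [mem_kerModule]
    simpa [mul_assoc] using h3
  obtain ⟨τ₀, hτ₀, hτ₀r⟩ := upperGL_mem_of_unipotent_mem hu α
  have hτr : reduction p (diagGL μ 1 * τ₀ * (diagGL μ 1)⁻¹) = unipotent (ZMod p) := by
    have hent : ∀ i j, red p (τ₀ i j) = upperGL α i j := by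
      intro i j
      rw [← reduction_apply, hτ₀r]
    ext i j
    rw [reduction_apply, conj_diagGL_entries]
    fin_cases i <;> fin_cases j <;> simp [hent, upperGL_coe, unipotent_coe, hx, hα0]
  obtain ⟨a, b, c, d, hτe⟩ := exists_entries hτr
  have hτK : diagGL μ 1 * τ₀ * (diagGL μ 1)⁻¹ ∈ K := conj_mem_map_conj hτ₀ _
  -- Remove the lower left entry of the lift.
  have hσK := K.mul_mem hτK ((kerModule K).smul_mem (-c) hKmem)
  have hσe : (diagGL μ 1 * τ₀ * (diagGL μ 1)⁻¹ * kerElt ((-c) • !![1, 0; 1, 1])).val =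
      !![1 + mulP p (a - c - c), 1 + mulP p (b - c); mulP p 0, 1 + mulP p (d - c)] := by
    ext i j
    rw [mul_kerElt_apply, hτr, unipotent_coe, hτe, Matrix.mul_apply, Fin.sum_univ_two]
    fin_cases i <;> fin_cases j <;> simp
    all_goals ring
  obtain ⟨X, hX⟩ := exists_kerElt_conj_entries hp3 hσe
  have hker : ∀ A, kerElt A ∈ K.map (MulAut.conj (kerElt X)).toMonoidHom ↔ kerElt A ∈ K := by
    intro A
    rw [mem_map_conj, ← kerElt_neg, ← kerElt_add, ← kerElt_add, neg_add_cancel_comm]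
  refine ⟨K.map (MulAut.conj (kerElt X)).toMonoidHom, (a - c - c + (d - c)) / 2,
    (conjugateSubgroups_map _ _).trans (conjugateSubgroups_map _ _),
    ⟨hKE.map_conj (by rw [reduction_kerElt]; simp), ?_, ?_, ?_⟩⟩
  · rwa [mem_kerModule, hker]
  · rwa [mem_kerModule, hker]
  · refine ⟨_, conj_mem_map_conj hσK _, ?_⟩
    rw [hX, map_zero]

section

variable {b : ZMod p}

lemma NongradedForm.unipotent_mem (hN : NongradedForm b H) :
    unipotent (ZMod p) ∈ H.map (reduction p) := by
  obtain ⟨V, hV, hVe⟩ := hN.lift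
  refine ⟨V, hV, reduction_eq_unipotent (a := b) (b := 0) (c := 0) (d := b) ?_⟩
  rw [hVe]; simp

lemma NongradedForm.mem_kerModule_iff (hp3 : 3 < p) (hN : NongradedForm b H)
    {B : Matrix (Fin 2) (Fin 2) (ZMod p)} :
    B ∈ kerModule H ↔ B 0 0 + B 1 1 = 2 * B 1 0 := by
  have h2 := two_ne_zero_of_three_lt hp3
  have he := e_mem_kerModule hp3 hN.unipotent_mem
  have hh := h_mem_kerModule hp3 hN.unipotent_mem hN.mem (by simp)
  have hspan : ∀ x y z : ZMod p, !![x + z, y; z, z - x] ∈ kerModule H := by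
    intro x y z
    refine mem_kerModule_of_e he (y := 0) ?_ y
    convert (kerModule H).add_mem ((kerModule H).smul_mem x hh)
      ((kerModule H).smul_mem z hN.mem) using 1
    ext i j
    fin_cases i <;> fin_cases j <;> simp
    ring
  constructor
  · intro hB
    by_contra hne
    set s := (B 0 0 + B 1 1) / 2 - B 1 0 with hs
    have hs0 : s ≠ 0 := by
      rw [hs, sub_ne_zero, Ne, div_eq_iff h2, mul_comm]
      exact hne
    have h1 : !![s, 0; 0, s] ∈ kerModule H := by
      convert (kerModule H).sub_mem hB (hspan ((B 0 0 - B 1 1) / 2) (B 0 1) (B 1 0)) using 1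
      ext i j
      fin_cases i <;> fin_cases j <;> simp [hs]
      all_goals field_simp; ring
    apply hN.not_mem
    convert (kerModule H).sub_mem hN.mem ((kerModule H).smul_mem s⁻¹ h1) using 1
    ext i j
    fin_cases i <;> fin_cases j <;> simp [hs0]
  · intro hB
    convert hspan ((B 0 0 - B 1 1) / 2) (B 0 1) (B 1 0) using 1
    ext i j
    fin_cases i <;> fin_cases j <;> simp
    all_goals field_simp
    · linear_combination hB
    · linear_combination hB

lemma NongradedForm.exists_pow (hN : NongradedForm b H) (n : ZMod p) :
    ∃ V ∈ H, reduction p V = upperGL n ∧ V 0 0 = 1 + mulP p (n * b) ∧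
      V 1 1 = 1 + mulP p (n * b) ∧ V 1 0 = 0 := by
  obtain ⟨V, hV, hVe⟩ := hN.lift
  have hVe' : V.val = !![1 + mulP p b, 1 + mulP p 0; mulP p 0, 1 + mulP p b] := by
    rw [hVe]; simp
  have hn : ((n.val : ℕ) : ZMod p) = n := ZMod.natCast_zmod_val n
  have hpow := pow_entries hVe' n.val
  rw [hn] at hpow
  refine ⟨V ^ n.val, H.pow_mem hV _, ?_, ?_, ?_, ?_⟩
  · rw [map_pow, reduction_eq_unipotent hVe', unipotent_pow, hn]
  all_goals rw [hpow]; simp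

/-- An element of `H` with reduction in the group of unipotent matrices has its trace determined by
its off-diagonal entries. -/
lemma NongradedForm.trace_eq (hp3 : 3 < p) (hN : NongradedForm b H)
    {g : GL (Fin 2) (ZMod (p ^ 2))} (hg : g ∈ H) {n y : ZMod p} (hn : reduction p g = upperGL n)
    (hy : g 1 0 = mulP p y) : g 0 0 + g 1 1 = 2 + mulP p (2 * (n * b) + 2 * y + n * y) := by
  obtain ⟨V, hV, hVr, hV00, hV11, hV10⟩ := hN.exists_pow n
  obtain ⟨B, hB⟩ := exists_eq_mul_kerElt (hn.trans hVr.symm)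
  have hBH : B ∈ kerModule H := by
    rw [hB] at hg
    exact (H.mul_mem_cancel_left hV).1 hg
  rw [hN.mem_kerModule_iff hp3] at hBH
  rw [hB, mul_kerElt_apply, hV10, hVr, upperGL_coe, zero_add, Matrix.mul_apply,
    Fin.sum_univ_two] at hy
  simp at hy
  have hy := mulP_injective hy
  rw [hB, mul_kerElt_apply, mul_kerElt_apply, hV00, hV11, hVr, upperGL_coe, Matrix.mul_apply,
    Matrix.mul_apply, Fin.sum_univ_two, Fin.sum_univ_two]
  have : (2 : ZMod (p ^ 2)) = 1 + 1 := by norm_num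
  rw [this, ← hy, show 2 * (n * b) + 2 * B 1 0 + n * B 1 0 = n * b + n * b + (B 0 0 + B 1 1) +
    n * B 1 0 by rw [hBH]; ring]
  simp
  abel

lemma NongradedForm.exists_mem (hN : NongradedForm b H) (n y : ZMod p) :
    ∃ g ∈ H, reduction p g = upperGL n ∧ g 1 0 = mulP p y := by
  obtain ⟨V, hV, hVr, -, -, hV10⟩ := hN.exists_pow n
  refine ⟨_, H.mul_mem hV ((kerModule H).smul_mem y hN.mem), ?_, ?_⟩
  · rw [map_mul, reduction_kerElt, mul_one, hVr]
  · rw [mul_kerElt_apply, hV10, hVr, upperGL_coe, Matrix.mul_apply, Fin.sum_univ_two]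
    simp

end

variable {b₁ b₂ : ZMod p}

/-- Among the elements of trace `2 + (4 + w) p` and lower left entry `w / m` times `p`, the
existence of one with reduction `(1, m; 0, 1)` is a quadratic equation for `m`. -/
lemma NongradedForm.isSquare_one_sub (hp3 : 3 < p) (hN₁ : NongradedForm b₁ H₁)
    (hN₂ : NongradedForm b₂ H₂) (hH : SameClasses H₁ H₂) {w : ZMod p}
    (hw : IsSquare (1 - b₁ * w)) : IsSquare (1 - b₂ * w) := by
  have h2 := two_ne_zero_of_three_lt hp3
  by_cases hw0 : w = 0
  · rw [hw0]; simp
  obtain ⟨m, hm, hmw⟩ : ∃ m : ZMod p, m ≠ 0 ∧ b₁ * m ^ 2 - 2 * m + w = 0 := by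
    obtain ⟨r, hr⟩ := hw
    by_cases hb : b₁ = 0
    · refine ⟨w / 2, div_ne_zero hw0 h2, ?_⟩
      rw [hb]; field_simp; ring
    · by_cases hr1 : 1 + r = 0
      · refine ⟨(1 - r) / b₁, div_ne_zero (fun h0 => h2 ?_) hb, ?_⟩
        · linear_combination hr1 + h0
        · field_simp
          linear_combination -hr
      · refine ⟨(1 + r) / b₁, div_ne_zero hr1 hb, ?_⟩
        field_simp
        linear_combination -hr
  obtain ⟨g, hg, hgr, hg10⟩ := hN₁.exists_mem m (w / m)
  obtain ⟨g', hg', hc⟩ := hH.1 g hg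
  have hc' := (reduction p).map_isConj hc
  rw [hgr] at hc'
  obtain ⟨n, hn, hgr'⟩ := exists_eq_upperGL_of_isConj hm (hN₂.equalEigenvalues g' hg').1 hc'
  obtain ⟨y, hy⟩ := exists_mulP_of_red_eq (x := g' 1 0) (y := 0) (by
    rw [← reduction_apply, hgr', upperGL_coe, map_zero]; simp)
  rw [zero_add] at hy
  have hl := lower_entry_of_isConj hp3 hc hg10 hy (hN₁.equalEigenvalues g hg).2
    (hN₂.equalEigenvalues g' hg').2
  have htr := trace_eq_of_isConj hc
  rw [hN₁.trace_eq hp3 hg hgr hg10, hN₂.trace_eq hp3 hg' hgr' hy, add_left_cancel_iff] at htr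
  have htr := mulP_injective htr
  rw [← reduction_apply, ← reduction_apply, hgr, hgr', upperGL_coe, upperGL_coe] at hl
  simp at hl
  rw [mul_div_cancel₀ _ hm] at hl htr
  have hs : m * b₁ + w / m = 2 := by
    field_simp
    linear_combination hmw
  have hs' : n * b₂ + y = 2 := by
    apply mul_left_cancel₀ h2
    linear_combination -htr + hl + 2 * hs
  refine ⟨1 - n * b₂, ?_⟩
  rw [hl]
  linear_combination (-n * b₂) * hs'

lemma NongradedForm.le_of_sameClasses (hp3 : 3 < p) {b : ZMod p} (hN₁ : NongradedForm b H₁)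
    (hN₂ : NongradedForm b H₂) (hH : SameClasses H₁ H₂) : H₁ ≤ H₂ := by
  intro g hg
  obtain ⟨V, hV, hVe⟩ := hN₁.lift
  have hV₂ : V ∈ H₂ := by
    obtain ⟨V', hV', hVe'⟩ := hN₂.lift
    rwa [Units.ext (hVe.trans hVe'.symm)]
  have hVr : reduction p V = unipotent (ZMod p) := by
    refine reduction_eq_unipotent (a := b) (b := 0) (c := 0) (d := b) ?_
    rw [hVe]; simp
  obtain ⟨n, hn⟩ := exists_mul_pow_diag hVr (hN₁.equalEigenvalues g hg).1
  refine (H₂.mul_mem_cancel_right (H₂.pow_mem hV₂ n)).1 ?_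
  have hx := H₁.mul_mem hg (H₁.pow_mem hV n)
  obtain ⟨v, hv⟩ := hN₁.equalEigenvalues.exists_scalar hx hn
  -- A conjugate of a matrix that is scalar modulo `p` has the same `p`-th power.
  obtain ⟨y, hy, hc⟩ := hH.1 _ hx
  have hyr : reduction p y = reduction p (diagGL v v) := by
    obtain ⟨r, hr⟩ := isConj_iff.1 ((reduction p).map_isConj hc)
    rw [← hr, hv, mul_inv_eq_iff_eq_mul]
    apply Units.ext
    rw [Units.val_mul, Units.val_mul, reduction_diagGL_coe, Matrix.eta_fin_two r.val]
    ext i j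
    fin_cases i <;> fin_cases j <;> simp [mul_comm]
  obtain ⟨B, hB⟩ := exists_eq_mul_kerElt (hv.trans (reduction_pow_p v).symm)
  have hB₁ : B ∈ kerModule H₁ := by
    have := hx
    rw [hB, ← pow_p_eq hv] at this
    exact (H₁.mul_mem_cancel_left (H₁.pow_mem hx p)).1 this
  rw [hN₁.mem_kerModule_iff hp3, ← hN₂.mem_kerModule_iff hp3] at hB₁
  rw [hB, ← pow_p_eq hyr]
  exact H₂.mul_mem (H₂.pow_mem hy p) hB₁

lemma NongradedForm.eq_of_sameClasses (hp3 : 3 < p) {ε : ZMod p} (hε : ¬ IsSquare ε)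
    (hN₁ : NongradedForm b₁ H₁) (hN₂ : NongradedForm b₂ H₂) (hH : SameClasses H₁ H₂) :
    H₁ = H₂ := by
  obtain rfl : b₁ = b₂ := eq_of_isSquare_one_sub_iff hp3 hε fun w =>
    ⟨hN₁.isSquare_one_sub hp3 hN₂ hH, hN₂.isSquare_one_sub hp3 hN₁ hH.symm⟩
  exact le_antisymm (hN₁.le_of_sameClasses hp3 hN₂ hH) (hN₂.le_of_sameClasses hp3 hN₁ hH.symm)

/-- Two subgroups that meet the same conjugacy classes are conjugate, if their elements have equal
eigenvalues modulo `p` and the first one is not graded. -/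
lemma conjugateSubgroups_of_not_graded (hp3 : 3 < p) {ε : ZMod p} (hε : ¬ IsSquare ε)
    (hE₁ : EqualEigenvalues H₁) (hE₂ : EqualEigenvalues H₂)
    (hu₁ : unipotent (ZMod p) ∈ H₁.map (reduction p))
    (hu₂ : unipotent (ZMod p) ∈ H₂.map (reduction p)) (hH : SameClasses H₁ H₂)
    (hG : ¬ Graded H₁) : ConjugateSubgroups H₁ H₂ := by
  obtain ⟨B, hB, hB0, hf⟩ : ∃ B ∈ kerModule H₁, B 1 0 ≠ 0 ∧ !![0, 0; 1, 0] ∉ kerModule H₁ := by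
    by_contra! h
    exact hG (hE₁.graded h)
  obtain ⟨K₁, b₁, hK₁, hN₁⟩ := exists_conj_nongradedForm hp3 hE₁ hu₁ hf hB hB0
  have hK : SameClasses K₁ H₂ := hH.of_conj hK₁ (.refl _)
  obtain ⟨B₂, hB₂, hB₂0, htr⟩ :=
    hK.exists_lower_ne_zero hε (e_mem_kerModule hp3 hN₁.unipotent_mem) hN₁.mem
  have hf₂ : !![0, 0; 1, 0] ∉ kerModule H₂ := by
    intro hf₂
    have he := e_mem_kerModule hp3 hu₂
    have hh := h_mem_kerModule hp3 hu₂ hB₂ hB₂0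
    have h1 : (1 : Matrix (Fin 2) (Fin 2) (ZMod p)) ∈ kerModule H₂ := by
      convert (kerModule H₂).sub_mem ((kerModule H₂).sub_mem hB₂
        ((kerModule H₂).smul_mem (B₂ 1 0) hf₂)) ((kerModule H₂).add_mem
        ((kerModule H₂).smul_mem (B₂ 0 1) he) ((kerModule H₂).smul_mem (B₂ 0 0 - 1) hh)) using 1
      ext i j
      fin_cases i <;> fin_cases j <;> simp
      linear_combination -htr
    -- The scalar matrix `1 + p` is conjugate only to itself.
    obtain ⟨g, hg, hc⟩ := hK.2 _ h1
    obtain ⟨r, rfl⟩ := exists_kerElt_of_isConj hc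
    rw [mul_one, Units.mul_inv] at hg
    apply hN₁.not_mem
    convert (kerModule K₁).sub_mem hN₁.mem (mem_kerModule.2 hg) using 1
    ext i j
    fin_cases i <;> fin_cases j <;> simp
  obtain ⟨K₂, b₂, hK₂, hN₂⟩ := exists_conj_nongradedForm hp3 hE₂ hu₂ hf₂ hB₂ hB₂0
  obtain rfl := hN₁.eq_of_sameClasses hp3 hε hN₂ (hK.of_conj (.refl _) hK₂)
  exact hK₁.trans hK₂.symm

lemma listedPair_of_equalEigenvalues (hp3 : 3 < p) {ε : ZMod p} (hε : ¬ IsSquare ε)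
    (hH : SameClasses H₁ H₂) (hnc : ¬ ConjugateSubgroups H₁ H₂)
    (hE₁ : EqualEigenvalues H₁) (hE₂ : EqualEigenvalues H₂)
    (hu₁ : unipotent (ZMod p) ∈ H₁.map (reduction p)) : ListedPair ε H₁ H₂ := by
  obtain ⟨τ₀, hτ₀, hτ₀r⟩ := hu₁
  obtain ⟨n, g, hg, hlist⟩ := exists_conj_pow_isListedLift hp3 hε hτ₀r
  set τ := g * τ₀ ^ n * g⁻¹
  have hτr := hlist.reduction_eq
  set K₁ := H₁.map (MulAut.conj g).toMonoidHom with hK₁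
  have hτ₁ : τ ∈ K₁ := conj_mem_map_conj (H₁.pow_mem hτ₀ n) g
  have hEK₁ : EqualEigenvalues K₁ := hE₁.map_conj hg
  -- Conjugate the second subgroup so that it contains the same lift.
  obtain ⟨x, hx, hc⟩ := (hH.of_conj (conjugateSubgroups_map H₁ g) (.refl H₂)).1 τ hτ₁
  obtain ⟨r, hr⟩ := isConj_iff.1 hc.symm
  have hr0 : reduction p r 1 0 = 0 := by
    have hc' := (reduction p).map_isConj hc
    rw [hτr, ← upperGL_one] at hc'
    obtain ⟨m, hm, hxm⟩ := exists_eq_upperGL_of_isConj one_ne_zero (hE₂ x hx).1 hc'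
    have h1 : reduction p r * upperGL m = unipotent (ZMod p) * reduction p r := by
      rw [← hxm, ← hτr, ← hr, map_mul, map_mul, map_inv, inv_mul_cancel_right]
    have h2 : (reduction p r * upperGL m) 1 1 = (unipotent (ZMod p) * reduction p r) 1 1 := by
      rw [h1]
    rw [Units.val_mul, Units.val_mul, Matrix.mul_apply, Matrix.mul_apply, Fin.sum_univ_two,
      Fin.sum_univ_two, upperGL_coe, unipotent_coe] at h2
    simpa [hm] using h2
  set K₂ := H₂.map (MulAut.conj r).toMonoidHom with hK₂
  have hτ₂ : τ ∈ K₂ := by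
    rw [← hr]; exact conj_mem_map_conj hx r
  have hEK₂ : EqualEigenvalues K₂ := hE₂.map_conj hr0
  have hcK₁ := conjugateSubgroups_map H₁ g
  have hcK₂ := conjugateSubgroups_map H₂ r
  rw [← hK₁] at hcK₁
  rw [← hK₂] at hcK₂
  have hK := hH.of_conj hcK₁ hcK₂
  have hncK : ¬ ConjugateSubgroups K₁ K₂ := fun h => hnc ((hcK₁.trans h).trans hcK₂.symm)
  have huK₁ : unipotent (ZMod p) ∈ K₁.map (reduction p) := ⟨τ, hτ₁, hτr⟩
  have huK₂ : unipotent (ZMod p) ∈ K₂.map (reduction p) := ⟨τ, hτ₂, hτr⟩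
  have hG₁ : Graded K₁ := by
    by_contra hG
    exact hncK (conjugateSubgroups_of_not_graded hp3 hε hEK₁ hEK₂ huK₁ huK₂ hK hG)
  have hG₂ : Graded K₂ := by
    by_contra hG
    exact hncK (conjugateSubgroups_of_not_graded hp3 hε hEK₂ hEK₁ huK₂ huK₁ hK.symm hG).symm
  refine (hG₁.listedPair hp3 hε hG₂ hK ?_ hlist hτ₁ hτ₂).of_conj hcK₁ hcK₂
  intro h
  exact hncK (h ▸ .refl _)

end

end LocConj

theorem mainTheorem3 (p : ℕ) (hp : p.Prime) (hp3 : 3 < p)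
    (ε : ZMod p) (hε : ¬ IsSquare ε)
    (H₁ H₂ : Subgroup (GL (Fin 2) (ZMod (p ^ 2))))
    (hH : LocConj.NontriviallyLocallyConjugate H₁ H₂)
    (h₁ : LocConj.unipotent (ZMod p) ∈ H₁.map (LocConj.reduction p))
    (h₂ : LocConj.unipotent (ZMod p) ∈ H₂.map (LocConj.reduction p)) :
    ∃ (τ k : GL (Fin 2) (ZMod (p ^ 2))) (D D' : Subgroup (GL (Fin 2) (ZMod (p ^ 2)))),
      LocConj.IsListedLift ε τ ∧ LocConj.IsListedKernelElement k ∧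
      LocConj.DiagonalSwaps D D' ∧ D ≠ D' ∧
      ((LocConj.ConjugateSubgroups H₁ (LocConj.generated τ k D) ∧
          LocConj.ConjugateSubgroups H₂ (LocConj.generated τ k D')) ∨
        (LocConj.ConjugateSubgroups H₁ (LocConj.generated τ k D') ∧
          LocConj.ConjugateSubgroups H₂ (LocConj.generated τ k D))) := by
  have : Fact p.Prime := ⟨hp⟩
  obtain ⟨hlc, hnc⟩ := hH
  have hS := hlc.sameClasses
  have hne : H₁ ≠ H₂ := by
    rintro rfl
    exact hnc (.refl _)
  have hup₁ : ∀ g ∈ H₁, LocConj.reduction p g 1 0 = 0 := by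
    by_contra! h
    exact hne (LocConj.eq_of_not_upper hp3 hε hS h₁ h₂ h)
  have hup₂ : ∀ g ∈ H₂, LocConj.reduction p g 1 0 = 0 := by
    by_contra! h
    exact hne (LocConj.eq_of_not_upper hp3 hε hS.symm h₂ h₁ h).symm
  by_cases hreg : ∃ h ∈ H₁, LocConj.red p (h 0 0) ≠ LocConj.red p (h 1 1)
  · exact LocConj.listedPair_of_distinct_eigenvalues hp3 hε hS hnc hup₁ hup₂ h₁ h₂ hreg
  · push Not at hreg
    refine LocConj.listedPair_of_equalEigenvalues hp3 hε hS hnc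
      (fun g hg => ⟨hup₁ g hg, hreg g hg⟩) (fun g hg => ⟨hup₂ g hg, ?_⟩) h₁
    by_contra hne'
    obtain ⟨g', hg', hc⟩ := hS.2 g hg
    exact LocConj.red_ne_of_isConj hc (hup₂ g hg) (hup₁ g' hg') hne' (hreg g' hg')
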